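/- All varieties are over $\mathbb{C}$. Let $Q\subset\mathbb{P}^2$ be an irreducible quartic curve and let $g(\widetilde Q)$ be the genus of its normalization $\widetilde Q$. A smooth conic $C\subset\mathbb{P}^2$ is called *even tangential* to $Q$ if every point $P\in C\cap Q$ is a smooth point of $Q$ and the intersection multiplicity $I_P(C,Q)$ is even for every $P\in C\cap Q$. Let $f_C:Z_C\to\mathbb{P}^2$ be the double cover with branch locus $C$ (unique up to isomorphism over $\mathbb{P}^2$; explicitly, $Z_C=\{w^2=F_C(x,y,z)\}\subset\mathbb{P}^3$ with $f_C([x:y:z:w])=[x:y:z]$, where $F_C=0$ is an equation of $C$), and let $\sigma$ be its covering involution. The conic $C$ is called *quadratic residue mod $Q$* if $f_C^*Q=Q^++Q^-$ as divisors, with irreducible curves $Q^+\neq Q^-$ such that $\sigma^*Q^+=Q^-$ and $f_C(Q^+)=f_C(Q^-)=Q$. (i) If $g(\widetilde Q)\ge 2$, then no smooth conic that is even tangential to $Q$ is quadratic residue mod $Q$. (ii) If $g(\widetilde Q)=0$, then every smooth conic that is even tangential to $Q$ is quadratic residue mod $Q$. -/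

import Mathlib

open MvPolynomial

noncomputable section

namespace QuarticConic

/-! ### Local multiplicities -/

/-- The length of the localization at the prime `P` of `R / I`, as a module over `R_P`.
For `R` the homogeneous coordinate ring of a projective space, `P` a homogeneous prime and `I` the
ideal generated by the equations of subvarieties without common component through the subvariety
`V(P)`, this is the intersection multiplicity along `V(P)`. -/
def lengthAt {R : Type*} [CommRing R] (P : Ideal R) [P.IsPrime] (I : Ideal R) : ℕ∞ :=
  Module.length (Localization.AtPrime P)
    (Localization.AtPrime P ⧸ I.map (algebraMap R (Localization.AtPrime P)))

/-! ### Plane curves -/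

/-- Forms on the projective plane over `ℂ` live here; `X 0, X 1, X 2` are the homogeneous
coordinates. A point of the plane is given by a nonzero vector of `Fin 3 → ℂ`. -/
abbrev PlanePoly : Type := MvPolynomial (Fin 3) ℂ

/-- The homogeneous prime ideal of the point `[p]` (for `p ≠ 0`): all polynomials `F` such that
`F (t p)` vanishes identically in `t`. -/
def pointIdeal (p : Fin 3 → ℂ) : Ideal PlanePoly :=
  RingHom.ker (aeval (R := ℂ) fun i => Polynomial.C (p i) * (Polynomial.X : Polynomial ℂ))

instance (p : Fin 3 → ℂ) : (pointIdeal p).IsPrime := by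
  exact RingHom.ker_isPrime _

/-- The intersection multiplicity `I_p(F, G)` of the curves `F = 0` and `G = 0` at `[p]`. -/
def intersectionMultiplicity (F G : PlanePoly) (p : Fin 3 → ℂ) : ℕ∞ :=
  lengthAt (pointIdeal p) (Ideal.span {F, G})

/-- `[p]` is a singular point of the reduced curve `F = 0`. -/
def IsSingularPoint (F : PlanePoly) (p : Fin 3 → ℂ) : Prop :=
  eval p F = 0 ∧ ∀ i, eval p (pderiv i F) = 0

/-- The curves `F = 0` and `G = 0` are reduced, have no common component, meet only in points
that are smooth on both, and have even intersection multiplicity at each of them. -/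
structure EvenTangential (F G : PlanePoly) : Prop where
  reduced_left : Squarefree F
  reduced_right : Squarefree G
  no_common_component : IsRelPrime F G
  smooth : ∀ p : Fin 3 → ℂ, p ≠ 0 → eval p F = 0 → eval p G = 0 →
    ¬ IsSingularPoint F p ∧ ¬ IsSingularPoint G p
  even : ∀ p : Fin 3 → ℂ, p ≠ 0 → eval p F = 0 → eval p G = 0 →
    ∃ n : ℕ, intersectionMultiplicity F G p = ((2 * n : ℕ) : ℕ∞)

/-- `F = 0` is a smooth conic. -/
structure IsSmoothConic (F : PlanePoly) : Prop where
  homogeneous : F.IsHomogeneous 2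
  smooth : ∀ p : Fin 3 → ℂ, p ≠ 0 → ¬ IsSingularPoint F p

/-- An irreducible plane curve of degree `d`. -/
structure IrreduciblePlaneCurve (d : ℕ) where
  form : PlanePoly
  homogeneous : form.IsHomogeneous d
  irreducible : Irreducible form

/-! ### Function fields of one variable: places, divisors, genus -/

section Genus

variable (k K : Type*) [Field k] [Field K] [Algebra k K]

/-- A place of `K / k`: a discrete valuation ring of `K` that contains `k`. If `K` is the function
field of a curve over an algebraically closed field `k`, these are the local rings of the closed
points of the smooth projective model of the curve, that is, of the normalization of the
projective curve. -/
structure Place where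
  ring : ValuationSubring K
  isDVR : IsDiscreteValuationRing ring
  algebraMap_mem : ∀ a : k, algebraMap k K a ∈ ring

variable {k K}

/-- The degree of a divisor on the smooth model (all points are rational over an algebraically
closed `k`). -/
def divisorDegree (D : Place k K →₀ ℤ) : ℤ := D.sum fun _ n => n

/-- The space `L(D)` of all `f` with `ord_v f ≥ - D v` at every place `v`. -/
def riemannRochSpace (D : Place k K →₀ ℤ) : Submodule k K where
  carrier := {f | ∀ v : Place k K, ∀ t : v.ring, Irreducible t → (t : K) ^ (D v) * f ∈ v.ring}
  zero_mem' := by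
    intro v t _
    simp
  add_mem' := by
    intro f g hf hg v t ht
    rw [mul_add]
    exact v.ring.add_mem _ _ (hf v t ht) (hg v t ht)
  smul_mem' := by
    intro c f hf v t ht
    rw [Algebra.smul_def, mul_left_comm]
    exact v.ring.mul_mem _ _ (v.algebraMap_mem c) (hf v t ht)

variable (k K)

/-- The genus of the function field `K / k`, for `k` algebraically closed: the maximum of
`deg D + 1 - ℓ(D)` over all divisors `D` (the divisor `0` gives the value `0`). -/
def genus : ℕ∞ :=
  ⨆ D : Place k K →₀ ℤ,
    (((divisorDegree D + 1 - (Module.finrank k (riemannRochSpace D) : ℤ)).toNat : ℕ) : ℕ∞)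

end Genus

namespace IrreduciblePlaneCurve

variable {d : ℕ} (Q : IrreduciblePlaneCurve d)

/-- The homogeneous coordinate ring of an irreducible plane curve. -/
abbrev coordinateRing : Type := PlanePoly ⧸ Ideal.span {Q.form}

instance : (Ideal.span {Q.form}).IsPrime :=
  (Ideal.span_singleton_prime Q.irreducible.ne_zero).2 Q.irreducible.prime

/-- The function field of an irreducible plane curve: the subfield of the fraction field of the
homogeneous coordinate ring generated by the quotients of two forms of equal degree. -/
def functionField : IntermediateField ℂ (FractionRing Q.coordinateRing) :=
  IntermediateField.adjoin ℂ
    {f | ∃ (n : ℕ) (a b : PlanePoly), a.IsHomogeneous n ∧ b.IsHomogeneous n ∧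
      f = algebraMap Q.coordinateRing (FractionRing Q.coordinateRing) (Ideal.Quotient.mk _ a) /
        algebraMap Q.coordinateRing (FractionRing Q.coordinateRing) (Ideal.Quotient.mk _ b)}

/-- The genus of the normalization of an irreducible plane curve. -/
def genusOfNormalization : ℕ∞ := genus ℂ Q.functionField

end IrreduciblePlaneCurve

/-! ### The double cover of the plane branched along a smooth conic

For a smooth conic `C`, the double cover `f : Z → ℙ²` with branch locus `C` is the smooth quadric
surface `Z = {w ^ 2 = C (x, y, z)}` in `ℙ³`, with `f [x : y : z : w] = [x : y : z]` and covering
involution `[x : y : z : w] ↦ [x : y : z : -w]`. It is unique up to isomorphism over `ℙ²` because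
`ℙ²` is simply connected, and its canonical resolution is the identity because `Z` is smooth. -/

/-- The coordinates on `ℙ³` are `x, y, z = X (castSucc 0), X (castSucc 1), X (castSucc 2)` and
`w = X (last 3)`. -/
abbrev SpacePoly : Type := MvPolynomial (Fin 4) ℂ

/-- The equation `w ^ 2 - C (x, y, z)` of the double cover. -/
def coverEquation (C : PlanePoly) : SpacePoly :=
  X (Fin.last 3) ^ 2 - rename Fin.castSucc C

/-- The covering involution `w ↦ -w` on polynomials. -/
def coverInvolution : SpacePoly →ₐ[ℂ] SpacePoly :=
  aeval fun i => if i = Fin.last 3 then - X i else X i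

/-- A prime divisor (irreducible curve) on the double cover `Z` of `ℙ²` branched along the
conic `C`: a homogeneous prime ideal of height two that contains the equation of `Z`. -/
@[ext]
structure PrimeDivisor (C : PlanePoly) where
  ideal : Ideal SpacePoly
  isPrime : ideal.IsPrime
  homogeneous : ∀ H ∈ ideal, ∀ n : ℕ, homogeneousComponent n H ∈ ideal
  height_eq : ideal.height = 2
  mem : coverEquation C ∈ ideal

/-- The divisor `f^* G` on `Z` of the plane curve `G = 0`, as the function that gives the
multiplicity of each prime divisor. -/
def pullbackDivisor (C G : PlanePoly) : PrimeDivisor C → ℕ∞ := fun D =>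
  haveI := D.isPrime
  lengthAt D.ideal (Ideal.span {coverEquation C, rename Fin.castSucc G})

/-- `f(D)` is the plane curve `G = 0`. -/
def ImageIs {C : PlanePoly} (D : PrimeDivisor C) (G : PlanePoly) : Prop :=
  ∀ p : Fin 3 → ℂ, p ≠ 0 → ((∃ w : ℂ, ∀ H ∈ D.ideal, eval (Fin.snoc p w : Fin 4 → ℂ) H = 0) ↔
    eval p G = 0)

open Classical in
/-- The smooth conic `C` is a quadratic residue curve modulo the irreducible plane curve `G = 0`:
the curve `G = 0` is a splitting curve with respect to the double cover `f` branched along `C`,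
that is, `f^* G = D⁺ + D⁻` with `D⁺ ≠ D⁻`, `σ^* D⁺ = D⁻` and `f(D⁺) = f(D⁻) = {G = 0}`. -/
def IsQuadraticResidue (C G : PlanePoly) : Prop :=
  ∃ Dp Dm : PrimeDivisor C,
    pullbackDivisor C G = Pi.single Dp 1 + Pi.single Dm 1 ∧
    Dp ≠ Dm ∧
    Dm.ideal = Dp.ideal.comap coverInvolution ∧
    ImageIs Dp G ∧ ImageIs Dm G

end QuarticConic

end

/-!
Let `C` be a conic and `K` the function field of the normalization of the quartic `Q`. After
division by the square of a linear form, `C` becomes a rational function `h ∈ K`. The inverse image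
of `Q` in the double cover `w ^ 2 = C` has the function ring `K[w] / (w ^ 2 - h)`, so `C` is a
quadratic residue modulo `Q` precisely if `h` is a square in `K` (`isQuadraticResidue_of_sq_eq`,
`IsQuadraticResidue.isSquare`). In that case the two components `Q⁺` and `Q⁻` are the closures of
the points `(x : y : z : ±√h)`, with the homogeneous prime ideals `coneIdeal`.

*Genus zero.* At a smooth point of `Q`, the order of `h` is the intersection multiplicity of `C` and
`Q`, so for an even tangential conic all zeros and poles of `h` have even order
(`IrreduciblePlaneCurve.even_ord_aeval_coord`). If `E` is half the divisor of `h`, then `deg E = 0`,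
and genus zero gives `ℓ(E) > 0`. A nonzero `f ∈ L(E)` has the property that `h f ^ 2` has no poles,
so it is constant and `h` is a square (`isSquare_of_even_ord`).

*Genus at least two.* In suitable coordinates the conic is `b ^ 2 = a c`, and with `A = a / c` and
`B = b / c` a quadratic residue means `B ^ 2 - A = w ^ 2` in `K`. The double cover is the quadric
`ℙ¹ × ℙ¹` with the rulings `u = B - w` and `v = B + w`, and `(u - t) (v - t) = A - 2 t B + t ^ 2`
is, up to the denominator `c`, the equation of a tangent line of the conic, which meets the quartic
in four points. Hence `[K : ℂ(u)] + [K : ℂ(v)] ≤ 4`: the curve `Q⁺` has bidegree `(m, n)` on the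
quadric with `m + n ≤ 4`, and such a curve has geometric genus at most one
(`genus_le_one_of_finrank_add_le`, `IrreduciblePlaneCurve.genus_le_one_of_isSquare`).

The theory of curves that this takes is developed for an abstract function field `K / k` of one
variable (`IsCurveField`) in terms of its places. A nonconstant `x` has `[K : k(x)]` zeros
(`sum_ord_zeros`), by the identity `∑ e f = n` for the integral closure of `k[x]` in `K`; from this
follow the finiteness of `L(D)` and the bound of the genus by the value of `deg D + 1 - ℓ(D)` at
divisors of large degree (`genus_le_of_unbounded`).
-/

noncomputable section

namespace QuarticConic

/-! ### The order of vanishing at a place -/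

namespace Place

variable {k K : Type*} [Field k] [Field K] [Algebra k K] (v : Place k K)

instance : IsDiscreteValuationRing v.ring := v.isDVR

@[ext]
theorem ext {v w : Place k K} (h : v.ring = w.ring) : v = w := by
  cases v; cases w; cases h; rfl

theorem exists_unit_mul_zpow {t : v.ring} (ht : Irreducible t) {f : K} (hf : f ≠ 0) :
    ∃ (n : ℤ) (u : v.ringˣ), f = (u : v.ring) * (t : K) ^ n := by
  have ht0 : (t : K) ≠ 0 := by
    simpa using ht.ne_zero
  obtain ⟨a, b, hb, rfl⟩ := IsFractionRing.div_surjective (A := v.ring) f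
  have hb0 : b ≠ 0 := nonZeroDivisors.ne_zero hb
  have ha0 : a ≠ 0 := by
    rintro rfl
    simp at hf
  obtain ⟨m, u, rfl⟩ := IsDiscreteValuationRing.eq_unit_mul_pow_irreducible ha0 ht
  obtain ⟨n, w, rfl⟩ := IsDiscreteValuationRing.eq_unit_mul_pow_irreducible hb0 ht
  refine ⟨m - n, u * w⁻¹, ?_⟩
  have hw : (((w⁻¹ : v.ringˣ) : v.ring) : K) * ((w : v.ring) : K) = 1 := by
    rw [← MulMemClass.coe_mul, Units.inv_mul, OneMemClass.coe_one]
  have hw0 : ((w : v.ring) : K) ≠ 0 := right_ne_zero_of_mul_eq_one hw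
  rw [ValuationSubring.algebraMap_apply, ValuationSubring.algebraMap_apply, zpow_sub₀ ht0]
  push_cast
  rw [eq_div_of_mul_eq hw0 hw]
  simp only [zpow_natCast]
  field_simp

/-- A local parameter at the place `v`. -/
def uniformizer : v.ring := (IsDiscreteValuationRing.exists_irreducible v.ring).choose

theorem irreducible_uniformizer : Irreducible v.uniformizer :=
  (IsDiscreteValuationRing.exists_irreducible v.ring).choose_spec

theorem uniformizer_ne_zero : (v.uniformizer : K) ≠ 0 := by
  simpa using v.irreducible_uniformizer.ne_zero

open Classical in
/-- The order of vanishing of `f` at the place `v`, with the value `0` for `f = 0`. -/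
def ord (f : K) : ℤ :=
  if hf : f = 0 then 0 else (v.exists_unit_mul_zpow v.irreducible_uniformizer hf).choose

theorem unit_ne_zero (u : v.ringˣ) : ((u : v.ring) : K) ≠ 0 := by
  simp

theorem exists_eq_unit_mul_zpow_ord {f : K} (hf : f ≠ 0) :
    ∃ u : v.ringˣ, f = (u : v.ring) * (v.uniformizer : K) ^ v.ord f := by
  rw [ord, dif_neg hf]
  exact (v.exists_unit_mul_zpow v.irreducible_uniformizer hf).choose_spec

theorem unit_mul_zpow_mem_iff {t : v.ring} (ht : Irreducible t) (u : v.ringˣ) (n : ℤ) :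
    ((u : v.ring) : K) * (t : K) ^ n ∈ v.ring ↔ 0 ≤ n := by
  have ht0 : (t : K) ≠ 0 := by
    simpa using ht.ne_zero
  constructor
  · intro h
    by_contra! hn
    obtain ⟨m, rfl⟩ : ∃ m : ℕ, n = -(m + 1 : ℕ) := ⟨(-n - 1).toNat, by omega⟩
    apply ht.not_isUnit
    refine isUnit_iff_exists_inv.2 ⟨t ^ m * (⟨_, h⟩ * (u⁻¹ : v.ringˣ)), ?_⟩
    apply Subtype.ext
    have hu : (((u⁻¹ : v.ringˣ) : v.ring) : K) * ((u : v.ring) : K) = 1 := by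
      rw [← MulMemClass.coe_mul, Units.inv_mul, OneMemClass.coe_one]
    change (t : K) * ((t : K) ^ m * (((u : v.ring) : K) * (t : K) ^ (-((m + 1 : ℕ) : ℤ)) *
      (((u⁻¹ : v.ringˣ) : v.ring) : K))) = 1
    rw [zpow_neg, zpow_natCast]
    calc _ = ((((u⁻¹ : v.ringˣ) : v.ring) : K) * ((u : v.ring) : K)) *
          ((t : K) ^ (m + 1) * ((t : K) ^ (m + 1))⁻¹) := by ring
      _ = 1 := by rw [hu, mul_inv_cancel₀ (pow_ne_zero _ ht0), one_mul]
  · intro hn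
    lift n to ℕ using hn
    rw [zpow_natCast]
    exact mul_mem (u : v.ring).2 (pow_mem t.2 n)

theorem ord_nonneg_iff {f : K} : 0 ≤ v.ord f ↔ f ∈ v.ring := by
  by_cases hf : f = 0
  · subst hf
    simp [ord]
  · obtain ⟨u, hu⟩ := v.exists_eq_unit_mul_zpow_ord hf
    conv_rhs => rw [hu]
    rw [unit_mul_zpow_mem_iff _ v.irreducible_uniformizer]

/-- The order does not depend on the local parameter that is used to compute it. -/
theorem ord_eq_of_eq {t : v.ring} (ht : Irreducible t) {f : K} {u : v.ringˣ} {n : ℤ}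
    (h : f = (u : v.ring) * (t : K) ^ n) : v.ord f = n := by
  have ht0 : (t : K) ≠ 0 := by simpa using ht.ne_zero
  have hf : f ≠ 0 := h ▸ mul_ne_zero (v.unit_ne_zero u) (zpow_ne_zero _ ht0)
  obtain ⟨w, hw⟩ := v.exists_eq_unit_mul_zpow_ord hf
  obtain ⟨c, hc⟩ := IsDiscreteValuationRing.associated_of_irreducible v.ring
    v.irreducible_uniformizer ht
  have hc' : (t : K) = v.uniformizer * ((c : v.ring) : K) := by
    rw [← hc]; push_cast; rfl
  have hcu : ∀ m : ℤ, (((c ^ m : v.ringˣ) : v.ring) : K) = ((c : v.ring) : K) ^ m := by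
    intro m
    have := congrArg Units.val (map_zpow (Units.map (algebraMap v.ring K : v.ring →* K)) c m)
    rw [Units.val_zpow_eq_zpow_val] at this
    exact this
  rw [hc', mul_zpow, ← hcu] at h
  have hinv : ∀ a : v.ringˣ, (((a⁻¹ : v.ringˣ) : v.ring) : K) = (((a : v.ring) : K))⁻¹ := by
    intro a
    apply eq_inv_of_mul_eq_one_left
    rw [← MulMemClass.coe_mul, Units.inv_mul, OneMemClass.coe_one]
  have key : ∀ (a b : v.ringˣ) (i j : ℤ), ((a : v.ring) : K) * (v.uniformizer : K) ^ i =
      ((b : v.ring) : K) * (v.uniformizer : K) ^ j → i ≤ j := by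
    intro a b i j hij
    have h1 : (((a * b⁻¹)⁻¹ : v.ringˣ) : K) * (v.uniformizer : K) ^ (j - i) = 1 := by
      rw [zpow_sub₀ v.uniformizer_ne_zero, hinv]
      rw [Units.val_mul, MulMemClass.coe_mul, hinv]
      have := v.unit_ne_zero a
      have := v.unit_ne_zero b
      have := zpow_ne_zero i v.uniformizer_ne_zero
      field_simp
      rw [← hij]
    have := (v.unit_mul_zpow_mem_iff v.irreducible_uniformizer _ (j - i)).1
      (h1 ▸ one_mem v.ring)
    omega
  have h2 : ((w : v.ring) : K) * (v.uniformizer : K) ^ v.ord f =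
      (((u * c ^ n : v.ringˣ) : v.ring) : K) * (v.uniformizer : K) ^ n := by
    rw [← hw, h]; push_cast; ring
  exact le_antisymm (key _ _ _ _ h2) (key _ _ _ _ h2.symm)

theorem ord_mul {f g : K} (hf : f ≠ 0) (hg : g ≠ 0) : v.ord (f * g) = v.ord f + v.ord g := by
  obtain ⟨u, hu⟩ := v.exists_eq_unit_mul_zpow_ord hf
  obtain ⟨w, hw⟩ := v.exists_eq_unit_mul_zpow_ord hg
  refine v.ord_eq_of_eq (u := u * w) v.irreducible_uniformizer ?_
  rw [zpow_add₀ v.uniformizer_ne_zero]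
  conv_lhs => rw [hu, hw]
  push_cast
  ring

@[simp] theorem ord_zero : v.ord 0 = 0 := by simp [ord]

@[simp] theorem ord_one : v.ord 1 = 0 := by
  have := v.ord_mul (one_ne_zero (α := K)) one_ne_zero
  rw [mul_one] at this
  omega

theorem ord_uniformizer {t : v.ring} (ht : Irreducible t) : v.ord (t : K) = 1 :=
  v.ord_eq_of_eq (u := 1) ht (by simp)

@[simp] theorem ord_inv (f : K) : v.ord f⁻¹ = - v.ord f := by
  by_cases hf : f = 0
  · simp [hf]
  · have := v.ord_mul hf (inv_ne_zero hf)
    rw [mul_inv_cancel₀ hf, ord_one] at this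
    omega

theorem ord_pow (f : K) (n : ℕ) : v.ord (f ^ n) = n * v.ord f := by
  by_cases hf : f = 0
  · subst hf
    rcases n with _ | n <;> simp
  · induction n with
    | zero => simp
    | succ n ih => rw [pow_succ, v.ord_mul (pow_ne_zero _ hf) hf, ih]; push_cast; ring

theorem ord_zpow (f : K) (n : ℤ) : v.ord (f ^ n) = n * v.ord f := by
  obtain ⟨m, rfl | rfl⟩ := n.eq_nat_or_neg
  · rw [zpow_natCast, ord_pow]
  · rw [zpow_neg, ord_inv, zpow_natCast, ord_pow]; ring

theorem le_ord_iff {f : K} (hf : f ≠ 0) {n : ℤ} {t : v.ring} (ht : Irreducible t) :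
    -n ≤ v.ord f ↔ (t : K) ^ n * f ∈ v.ring := by
  have ht0 : (t : K) ≠ 0 := by simpa using ht.ne_zero
  rw [← ord_nonneg_iff, v.ord_mul (zpow_ne_zero _ ht0) hf, ord_zpow, v.ord_uniformizer ht]
  omega

theorem le_ord_add {f g : K} (hfg : f + g ≠ 0) {n : ℤ} (hf : f ≠ 0 → n ≤ v.ord f)
    (hg : g ≠ 0 → n ≤ v.ord g) : n ≤ v.ord (f + g) := by
  have key : ∀ h : K, (h ≠ 0 → n ≤ v.ord h) → (v.uniformizer : K) ^ (-n) * h ∈ v.ring := by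
    intro h hh
    by_cases h0 : h = 0
    · simp [h0]
    · rw [← v.le_ord_iff h0 v.irreducible_uniformizer]
      simpa using hh h0
  have := add_mem (key f hf) (key g hg)
  rw [← mul_add, ← v.le_ord_iff hfg v.irreducible_uniformizer] at this
  simpa using this

theorem ord_algebraMap (c : k) : v.ord (algebraMap k K c) = 0 := by
  by_cases hc : c = 0
  · simp [hc]
  · have h1 := v.ord_nonneg_iff.2 (v.algebraMap_mem c)
    have h2 := v.ord_nonneg_iff.2 (v.algebraMap_mem c⁻¹)
    rw [map_inv₀, ord_inv] at h2
    omega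

theorem mem_maximalIdeal_iff {f : v.ring} (hf : f ≠ 0) :
    f ∈ IsLocalRing.maximalIdeal v.ring ↔ 0 < v.ord (f : K) := by
  have hf' : (f : K) ≠ 0 := by simpa using hf
  have h1 := v.ord_nonneg_iff.2 f.2
  rw [IsLocalRing.mem_maximalIdeal, mem_nonunits_iff, lt_iff_le_and_ne, and_iff_right h1,
    not_iff_not]
  constructor
  · rintro ⟨u, rfl⟩
    exact (v.ord_eq_of_eq (u := u) (n := 0) v.irreducible_uniformizer (by simp)).symm
  · intro h
    have h2 : (f : K)⁻¹ ∈ v.ring := by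
      rw [← v.ord_nonneg_iff, ord_inv]; omega
    refine isUnit_iff_exists_inv.2 ⟨⟨_, h2⟩, Subtype.ext ?_⟩
    push_cast
    exact mul_inv_cancel₀ hf'

end Place

theorem mem_riemannRochSpace_iff {k K : Type*} [Field k] [Field K] [Algebra k K]
    {D : Place k K →₀ ℤ} {f : K} (hf : f ≠ 0) :
    f ∈ riemannRochSpace D ↔ ∀ v : Place k K, - D v ≤ v.ord f := by
  constructor
  · intro h v
    exact (v.le_ord_iff hf v.irreducible_uniformizer).2 (h v _ v.irreducible_uniformizer)
  · intro h v t ht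
    exact (v.le_ord_iff hf ht).1 (h v)

/-! ### Places and primes of a Dedekind domain -/

section Dedekind

open IsDedekindDomain WithZero

variable (k : Type*) {B K : Type*} [Field k] [Field K] [Algebra k K] [CommRing B]
  [IsDedekindDomain B] [Algebra k B] [Algebra B K] [IsFractionRing B K] [IsScalarTower k B K]

/-- The place of the fraction field `K` given by a nonzero prime of a Dedekind domain. -/
def placeOfPrime (q : HeightOneSpectrum B) : Place k K where
  ring := q.valuationSubringAtPrime K
  isDVR := IsLocalization.AtPrime.isDiscreteValuationRing_of_dedekind_domain B q.ne_bot
    (HeightOneSpectrum.valuationSubringAtPrime K q)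
  algebraMap_mem a := by
    rw [HeightOneSpectrum.valuationSubringAtPrime_eq_valuationSubring,
      Valuation.mem_valuationSubring_iff, IsScalarTower.algebraMap_apply k B K]
    exact q.valuation_le_one _

theorem mem_placeOfPrime_iff (q : HeightOneSpectrum B) {f : K} :
    f ∈ (placeOfPrime k q : Place k K).ring ↔ q.valuation K f ≤ 1 := by
  change f ∈ HeightOneSpectrum.valuationSubringAtPrime K q ↔ _
  rw [HeightOneSpectrum.valuationSubringAtPrime_eq_valuationSubring,
    Valuation.mem_valuationSubring_iff]

theorem valuation_eq_exp_neg_ord_placeOfPrime (q : HeightOneSpectrum B) {f : K} (hf : f ≠ 0) :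
    q.valuation K f = exp (-(placeOfPrime k q : Place k K).ord f) := by
  set v : Place k K := placeOfPrime k q
  have hmem : ∀ g : K, g ∈ v.ring ↔ q.valuation K g ≤ 1 := fun g => mem_placeOfPrime_iff k q
  have hunit : ∀ u : v.ringˣ, q.valuation K ((u : v.ring) : K) = 1 := by
    intro u
    apply le_antisymm ((hmem _).1 (u : v.ring).2)
    have h1 : (((u⁻¹ : v.ringˣ) : v.ring) : K) * ((u : v.ring) : K) = 1 := by
      rw [← MulMemClass.coe_mul, Units.inv_mul, OneMemClass.coe_one]
    have h2 := congrArg (q.valuation K) h1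
    rw [map_mul, map_one] at h2
    calc (1 : ℤᵐ⁰) = _ := h2.symm
      _ ≤ 1 * q.valuation K ((u : v.ring) : K) := by
        gcongr
        exact (hmem _).1 ((u⁻¹ : v.ringˣ) : v.ring).2
      _ = _ := one_mul _
  have hval : ∀ g : K, g ≠ 0 → q.valuation K g = (q.valuation K v.uniformizer) ^ v.ord g := by
    intro g hg
    obtain ⟨u, hu⟩ := v.exists_eq_unit_mul_zpow_ord hg
    conv_lhs => rw [hu]
    rw [map_mul, hunit, one_mul, map_zpow₀]
  obtain ⟨j, hj⟩ : ∃ j : ℤ, q.valuation K (v.uniformizer : K) = exp j :=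
    ⟨_, (exp_log ((Valuation.ne_zero_iff _).2 v.uniformizer_ne_zero)).symm⟩
  obtain ⟨π, hπ⟩ := q.valuation_exists_uniformizer K
  have hπ0 : π ≠ 0 := by
    rintro rfl
    rw [map_zero] at hπ
    exact exp_ne_zero hπ.symm
  have h1 : j ≤ 0 := by
    have := (hmem _).1 v.uniformizer.2
    rw [hj, ← exp_zero, exp_le_exp] at this
    exact this
  have h2 : v.ord π * j = -1 := by
    have := hval π hπ0
    rw [hj, ← exp_zsmul] at this
    rw [this, exp_inj] at hπ
    simpa using hπ
  have h3 : j = -1 := by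
    have : j ∣ 1 := ⟨-v.ord π, by linarith⟩
    rcases Int.isUnit_iff.1 (isUnit_of_dvd_one this) with h | h <;> omega
  rw [hval f hf, hj, h3, ← exp_zsmul]
  simp

theorem ord_placeOfPrime (q : HeightOneSpectrum B) {b : B} (hb : b ≠ 0) :
    (placeOfPrime k q : Place k K).ord (algebraMap B K b) =
      multiplicity q.asIdeal (Ideal.span {b}) := by
  have h := valuation_eq_exp_neg_ord_placeOfPrime k q (f := algebraMap B K b) (by simpa using hb)
  rw [q.valuation_of_algebraMap, q.intValuation_eq_exp_neg_multiplicity hb, exp_inj] at h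
  omega

theorem ord_placeOfPrime_pos (q : HeightOneSpectrum B) {b : B} (hb : b ≠ 0) :
    0 < (placeOfPrime k q : Place k K).ord (algebraMap B K b) ↔ b ∈ q.asIdeal := by
  have h := valuation_eq_exp_neg_ord_placeOfPrime k q (f := algebraMap B K b) (by simpa using hb)
  rw [← q.valuation_lt_one_iff_mem (K := K), h, ← exp_zero, exp_lt_exp]
  omega

theorem placeOfPrime_injective :
    Function.Injective (placeOfPrime k : HeightOneSpectrum B → Place k K) := by
  intro p q h
  ext b
  by_cases hb : b = 0
  · simp [hb]
  · rw [← ord_placeOfPrime_pos (K := K) k p hb, ← ord_placeOfPrime_pos (K := K) k q hb, h]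

/-- A place at which all of `B` is regular, and at which some element of `B` vanishes, comes from
a prime of `B`: the local ring at that prime is a maximal subring. -/
theorem exists_placeOfPrime_eq (v : Place k K) (hB : ∀ b : B, algebraMap B K b ∈ v.ring)
    {b : B} (hb : b ≠ 0) (hbv : 0 < v.ord (algebraMap B K b)) :
    ∃ q : HeightOneSpectrum B, placeOfPrime k q = v := by
  let φ : B →+* v.ring := (algebraMap B K).codRestrict v.ring hB
  have hφ : ∀ b, ((φ b : v.ring) : K) = algebraMap B K b := fun b => rfl
  have hφ0 : ∀ b, b ≠ 0 → φ b ≠ 0 := by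
    intro b hb h
    have := congrArg (Subtype.val) h
    rw [hφ] at this
    exact hb (by simpa using this)
  have hmem : b ∈ (IsLocalRing.maximalIdeal v.ring).comap φ := by
    rw [Ideal.mem_comap, v.mem_maximalIdeal_iff (hφ0 b hb), hφ]
    exact hbv
  let q : HeightOneSpectrum B := ⟨(IsLocalRing.maximalIdeal v.ring).comap φ, inferInstance, by
    intro h
    rw [h] at hmem
    exact hb (by simpa using hmem)⟩
  refine ⟨q, Place.ext (ValuationSubring.eq_of_le_of_ne_top _ ?_ ?_)⟩
  · intro f hf
    have hf' : q.valuation K f ≤ 1 := (mem_placeOfPrime_iff k q).1 hf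
    obtain ⟨n, d, hnd⟩ := q.exists_primeCompl_mul_eq_of_integer f hf'
    have hd : IsUnit (φ d) := by
      have : (d : B) ∉ (IsLocalRing.maximalIdeal v.ring).comap φ := d.2
      rw [Ideal.mem_comap, IsLocalRing.mem_maximalIdeal, mem_nonunits_iff, not_not] at this
      exact this
    obtain ⟨e, he⟩ := isUnit_iff_exists_inv.1 hd
    have he' : algebraMap B K d * (e : K) = 1 := by
      rw [← hφ, ← MulMemClass.coe_mul, he, OneMemClass.coe_one]
    have : f = algebraMap B K n * (e : K) := by
      rw [← hnd, mul_assoc, he', mul_one]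
    rw [this]
    exact mul_mem (hB n) e.2
  · intro h
    have : (algebraMap B K b)⁻¹ ∈ v.ring := by rw [h]; trivial
    rw [← v.ord_nonneg_iff, v.ord_inv] at this
    omega

end Dedekind

/-! ### Zeros of a function on a curve -/

/-- `K / k` is a function field of one variable (over an algebraically closed field `k`): `K` is
finite over `k(x)` for every nonconstant `x`. -/
class IsCurveField (k K : Type*) [Field k] [Field K] [Algebra k K] : Prop where
  finiteDimensional : ∀ x : K, x ∉ Set.range (algebraMap k K) →
    FiniteDimensional (IntermediateField.adjoin k {x}) K

/-- A prime is rational if every element is congruent to one of the base ring. -/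
theorem inertiaDeg_eq_one {R S : Type*} [CommRing R] [CommRing S] [Algebra R S] (p : Ideal R)
    (q : Ideal S) [p.IsMaximal] [q.IsMaximal] [q.LiesOver p]
    (h : ∀ b : S, ∃ a : R, b - algebraMap R S a ∈ q) : q.inertiaDeg R = 1 := by
  let := Ideal.Quotient.field p
  rw [Ideal.inertiaDeg_eq_of_isMaximal p q]
  refine finrank_eq_one (1 : S ⧸ q) one_ne_zero fun b => ?_
  obtain ⟨b, rfl⟩ := Ideal.Quotient.mk_surjective b
  obtain ⟨a, ha⟩ := h b
  refine ⟨Ideal.Quotient.mk p a, ?_⟩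
  rw [Algebra.smul_def, mul_one]
  exact (Ideal.Quotient.eq.2 ha).symm

section CurveField

open IntermediateField IsDedekindDomain

variable {k K : Type*} [Field k] [Field K] [Algebra k K] [IsAlgClosed k]

theorem transcendental_of_notMem_range {x : K} (hx : x ∉ Set.range (algebraMap k K)) :
    Transcendental k x := by
  intro h
  have hi := h.isIntegral
  exact hx (minpoly.mem_range_of_degree_eq_one k x
    (IsAlgClosed.degree_eq_one_of_irreducible k (minpoly.irreducible hi)))

variable [IsCurveField k K]

/-- Every place is rational: a function that is regular at `v` has a value in `k` at `v`. -/
theorem Place.exists_sub_algebraMap (v : Place k K) {f : K} (hf : f ∈ v.ring) :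
    ∃ c : k, f = algebraMap k K c ∨ 0 < v.ord (f - algebraMap k K c) := by
  by_contra! hcon
  have hx : f ∉ Set.range (algebraMap k K) := by
    rintro ⟨c, rfl⟩
    exact (hcon c).1 rfl
  have htr := transcendental_of_notMem_range hx
  have := IsCurveField.finiteDimensional f hx
  have hmem : ∀ c : k, f - algebraMap k K c ∈ v.ring := fun c =>
    sub_mem hf (v.algebraMap_mem c)
  have hzero : ∀ c : k, v.ord (f - algebraMap k K c) = 0 := fun c =>
    le_antisymm (hcon c).2 (v.ord_nonneg_iff.2 (hmem c))
  -- Over an algebraically closed field every polynomial in `f` is a product of linear factors.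
  have hpoly : ∀ p : Polynomial k, p ≠ 0 → v.ord (Polynomial.aeval f p) = 0 := by
    intro p hp
    have hs := (IsAlgClosed.splits p).eq_prod_roots
    have key : ∀ s : Multiset k,
        (s.map fun c => f - algebraMap k K c).prod ≠ 0 ∧
        v.ord ((s.map fun c => f - algebraMap k K c).prod) = 0 := by
      intro s
      induction s using Multiset.induction_on with
      | empty => simp
      | cons a s ih =>
        have h0 : f - algebraMap k K a ≠ 0 := sub_ne_zero.2 (hcon a).1
        rw [Multiset.map_cons, Multiset.prod_cons, v.ord_mul h0 ih.1, hzero, ih.2]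
        exact ⟨mul_ne_zero h0 ih.1, rfl⟩
    have hlc : algebraMap k K p.leadingCoeff ≠ 0 := by simpa using hp
    rw [hs, map_mul, Polynomial.aeval_C, map_multiset_prod, Multiset.map_map]
    simp only [Function.comp_def, map_sub, Polynomial.aeval_X, Polynomial.aeval_C]
    rw [v.ord_mul hlc (key _).1, (key _).2, v.ord_algebraMap, add_zero]
  have hadj : ∀ y ∈ k⟮f⟯, y ∈ v.ring := by
    intro y hy
    obtain ⟨r, s, rfl⟩ := (IntermediateField.mem_adjoin_simple_iff k y).1 hy
    by_cases hr : r = 0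
    · simp [hr]
    by_cases hs : s = 0
    · simp [hs]
    rw [← v.ord_nonneg_iff, div_eq_mul_inv, v.ord_mul, v.ord_inv, hpoly r hr, hpoly s hs]
    · simp
    · exact fun h => hr ((transcendental_iff.1 htr) r h)
    · exact inv_ne_zero fun h => hs ((transcendental_iff.1 htr) s h)
  have htop : ∀ y : K, y ∈ v.ring := by
    intro y
    obtain ⟨p, hp, hpy⟩ := Algebra.IsIntegral.isIntegral (R := k⟮f⟯) y
    let φ : k⟮f⟯ →+* v.ring := (algebraMap k⟮f⟯ K).codRestrict v.ring fun a => hadj a a.2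
    have hint : IsIntegral v.ring y := by
      refine ⟨p.map φ, hp.map φ, ?_⟩
      rw [Polynomial.eval₂_map]
      exact hpy
    obtain ⟨a, rfl⟩ := IsIntegrallyClosed.isIntegral_iff.1 hint
    exact a.2
  have := v.ord_nonneg_iff.2 (htop (v.uniformizer : K)⁻¹)
  rw [v.ord_inv, v.ord_uniformizer v.irreducible_uniformizer] at this
  omega

/-- The zeros of `x ∈ A` on a curve with function field `K`, where `B` is a Dedekind domain with
fraction field `K` that is finite and free over `A`: counted with multiplicities, their number is
the rank of `B`. This is the identity `∑ e f = n` for the prime `(x)`, with all `f = 1`. -/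
theorem sum_ord_eq_finrank {A B : Type*} [CommRing A] [IsDomain A] [CommRing B] [IsDedekindDomain B]
    [Algebra A B] [Algebra k A] [Algebra k B] [IsScalarTower k A B] [Algebra B K]
    [IsFractionRing B K] [IsScalarTower k B K] [Module.Finite A B] [Module.Free A B] {xA : A}
    (hxB0 : algebraMap A B xA ≠ 0) (hpmax : (Ideal.span {xA}).IsMaximal)
    (hAv : ∀ v : Place k K, 0 < v.ord (algebraMap B K (algebraMap A B xA)) →
      ∀ a : A, algebraMap B K (algebraMap A B a) ∈ v.ring) :
    ∃ s : Finset (Place k K), (∀ v, v ∈ s ↔ 0 < v.ord (algebraMap B K (algebraMap A B xA))) ∧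
      ∑ v ∈ s, v.ord (algebraMap B K (algebraMap A B xA)) = Module.finrank A B := by
  classical
  set xB : B := algebraMap A B xA
  let p : Ideal A := Ideal.span {xA}
  have hpmax : p.IsMaximal := hpmax
  have hmap : p.map (algebraMap A B) = Ideal.span {xB} := by
    rw [Ideal.map_span, Set.image_singleton]
  have hmap0 : p.map (algebraMap A B) ≠ ⊥ := by
    rw [hmap, Ne, Ideal.span_singleton_eq_bot]
    exact hxB0
  have hover : ∀ q : Ideal B, q.IsPrime → (q.LiesOver p ↔ xB ∈ q) := by
    intro q hq
    constructor
    · intro h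
      have : xA ∈ q.under A := h.over ▸ Ideal.mem_span_singleton_self xA
      exact this
    · intro h
      refine ⟨hpmax.eq_of_le ?_ ?_⟩
      · exact Ideal.IsPrime.ne_top (Ideal.IsPrime.under A q)
      · rw [Ideal.span_singleton_le_iff_mem]
        exact h
  have hq0 : ∀ q : p.primesOver B, q.1 ≠ ⊥ := by
    intro q h
    have := (hover q.1 q.2.1).1 q.2.2
    rw [h] at this
    exact hxB0 (by simpa using this)
  let toPrime : p.primesOver B → HeightOneSpectrum B := fun q => ⟨q.1, q.2.1, hq0 q⟩
  have : Fintype (p.primesOver B) := Fintype.ofFinite _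
  have htoinj : Function.Injective fun q => (placeOfPrime k (toPrime q) : Place k K) := by
    intro q r h
    have := congrArg HeightOneSpectrum.asIdeal (placeOfPrime_injective k h)
    exact Subtype.ext this
  refine ⟨Finset.univ.image fun q => placeOfPrime k (toPrime q), ?_, ?_⟩
  · intro v
    rw [Finset.mem_image]
    constructor
    · rintro ⟨q, -, rfl⟩
      exact (ord_placeOfPrime_pos k (toPrime q) hxB0).2 ((hover q.1 q.2.1).1 q.2.2)
    · intro hv
      have hB : ∀ b : B, algebraMap B K b ∈ v.ring := by
        intro b
        obtain ⟨f, hf, hfb⟩ := Algebra.IsIntegral.isIntegral (R := A) b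
        let φ : A →+* v.ring :=
          ((algebraMap B K).comp (algebraMap A B)).codRestrict v.ring (hAv v hv)
        have hint : IsIntegral v.ring (algebraMap B K b) := by
          refine ⟨f.map φ, hf.map φ, ?_⟩
          rw [Polynomial.eval₂_map]
          have h := congrArg (algebraMap B K) hfb
          rw [map_zero, Polynomial.hom_eval₂] at h
          exact h
        obtain ⟨a, ha⟩ := IsIntegrallyClosed.isIntegral_iff.1 hint
        rw [← ha]
        exact a.2
      obtain ⟨q, rfl⟩ := exists_placeOfPrime_eq k v hB hxB0 hv
      have hxq : xB ∈ q.asIdeal := (ord_placeOfPrime_pos k q hxB0).1 hv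
      exact ⟨⟨q.asIdeal, q.isPrime, (hover _ q.isPrime).2 hxq⟩, Finset.mem_univ _, rfl⟩
  · rw [Finset.sum_image fun q _ r _ h => htoinj h]
    have hflat : Module.Flat A B := Module.Flat.of_free
    have hsum : ∑ q : p.primesOver B, q.1.ramificationIdx A * q.1.inertiaDeg A =
      Module.finrank A B := Ideal.sum_ramification_inertia_eq_finrank p B
    rw [← hsum]
    push_cast
    refine Finset.sum_congr rfl fun q _ => ?_
    have hqp : q.1.IsPrime := q.2.1
    have hqo : q.1.LiesOver p := q.2.2
    have hqm : q.1.IsMaximal := hqp.isMaximal (hq0 q)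
    have hinert : q.1.inertiaDeg A = 1 := by
      refine inertiaDeg_eq_one p q.1 fun b => ?_
      set v : Place k K := placeOfPrime k (toPrime q)
      have hbv : algebraMap B K b ∈ v.ring :=
        (mem_placeOfPrime_iff k _).2 (HeightOneSpectrum.valuation_le_one _ _)
      obtain ⟨c, hc⟩ := v.exists_sub_algebraMap hbv
      refine ⟨algebraMap k A c, ?_⟩
      by_cases h0 : b - algebraMap A B (algebraMap k A c) = 0
      · rw [h0]
        exact zero_mem _
      · have hpos := ord_placeOfPrime_pos (K := K) k (toPrime q) h0
        have heq : algebraMap B K (b - algebraMap A B (algebraMap k A c)) =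
          algebraMap B K b - algebraMap k K c := by
          rw [map_sub, ← IsScalarTower.algebraMap_apply k A B,
            ← IsScalarTower.algebraMap_apply k B K]
        rcases hc with hc | hc
        · refine absurd (FaithfulSMul.algebraMap_injective B K ?_) h0
          rw [heq, hc, sub_self, map_zero]
        · exact hpos.1 (heq ▸ hc)
    rw [hinert, Nat.cast_one, mul_one,
      Ideal.IsDedekindDomain.ramificationIdx_eq_multiplicity p q.1 hmap0, hmap]
    exact ord_placeOfPrime k (toPrime q) hxB0

variable [CharZero k]

open scoped IntermediateField.algebraAdjoinAdjoin in
/-- A nonconstant function `x` has finitely many zeros, and their number, counted with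
multiplicities, is `[K : k(x)]`. -/
theorem sum_ord_zeros {x : K} (hx : x ∉ Set.range (algebraMap k K)) :
    ∃ s : Finset (Place k K), (∀ v, v ∈ s ↔ 0 < v.ord x) ∧
      ∑ v ∈ s, v.ord x = Module.finrank k⟮x⟯ K := by
  have htr := transcendental_of_notMem_range hx
  have hfin := IsCurveField.finiteDimensional x hx
  let A := Algebra.adjoin k {x}
  let xA : A := ⟨x, Algebra.self_mem_adjoin_singleton k x⟩
  have hsurj : Function.Surjective (Polynomial.aeval (R := k) xA) := by
    rintro ⟨a, ha⟩
    obtain ⟨p, rfl⟩ := (Algebra.adjoin_singleton_eq_range_aeval k x ▸ ha :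
      a ∈ (Polynomial.aeval (R := k) x).range)
    refine ⟨p, Subtype.ext ?_⟩
    rw [← Subalgebra.coe_val, ← Polynomial.aeval_algHom_apply]
    rfl
  have hpid : IsPrincipalIdealRing A := IsPrincipalIdealRing.of_surjective
    (Polynomial.aeval (R := k) xA : Polynomial k →+* A) hsurj
  have : CharZero k⟮x⟯ := charZero_of_injective_algebraMap (algebraMap k k⟮x⟯).injective
  let B := integralClosure A K
  have hded : IsDedekindDomain B := integralClosure.isDedekindDomain A k⟮x⟯ K
  have hfrac : IsFractionRing B K :=
    integralClosure.isFractionRing_of_finite_extension k⟮x⟯ K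
  have hfinB : Module.Finite A B := IsIntegralClosure.finite A k⟮x⟯ K B
  have hfree : Module.Free A B := IsIntegralClosure.module_free A k⟮x⟯ K B
  have hrank : Module.finrank A B = Module.finrank k⟮x⟯ K := IsIntegralClosure.rank A k⟮x⟯ K B
  let p : Ideal A := Ideal.span {xA}
  have hdecomp : ∀ a : A, ∃ c : k, a - algebraMap k A c ∈ p := by
    intro a
    obtain ⟨f, rfl⟩ := hsurj a
    refine ⟨f.coeff 0, Ideal.mem_span_singleton.2 ⟨Polynomial.aeval xA f.divX, ?_⟩⟩
    have h := congrArg (Polynomial.aeval xA) (Polynomial.X_mul_divX_add f)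
    rw [map_add, map_mul, Polynomial.aeval_X, Polynomial.aeval_C] at h
    exact sub_eq_iff_eq_add.2 h.symm
  have hp1 : (1 : A) ∉ p := by
    intro h
    obtain ⟨a, ha⟩ := Ideal.mem_span_singleton.1 h
    obtain ⟨f, rfl⟩ := hsurj a
    have h1 : Polynomial.aeval x (Polynomial.X * f - 1) = 0 := by
      have := congrArg (A.val) ha
      rw [map_mul, ← Polynomial.aeval_algHom_apply] at this
      simp only [map_sub, map_mul, Polynomial.aeval_X, map_one]
      rw [map_one] at this
      exact sub_eq_zero.2 this.symm
    have h2 := congrArg (Polynomial.eval 0) (transcendental_iff.1 htr _ h1)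
    simp at h2
  have hpmax : p.IsMaximal := by
    refine Ideal.isMaximal_iff.2 ⟨hp1, fun J y hJ hy hyJ => ?_⟩
    obtain ⟨c, hc⟩ := hdecomp y
    have hc0 : c ≠ 0 := by
      rintro rfl
      rw [map_zero, sub_zero] at hc
      exact hy hc
    have h1 : algebraMap k A c ∈ J := by
      have := sub_mem hyJ (hJ hc)
      rwa [sub_sub_cancel] at this
    have h2 := J.mul_mem_left (algebraMap k A c⁻¹) h1
    rwa [← map_mul, inv_mul_cancel₀ hc0, map_one] at h2
  let xB : B := algebraMap A B xA
  have hxB : algebraMap B K xB = x := rfl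
  have hxB0 : xB ≠ 0 := by
    intro h
    rw [h, map_zero] at hxB
    exact hx ⟨0, by simp [← hxB]⟩
  have hAv : ∀ v : Place k K, 0 < v.ord x →
      ∀ a : A, algebraMap B K (algebraMap A B a) ∈ v.ring := by
    intro v hv a
    have hxv : x ∈ v.ring := v.ord_nonneg_iff.1 hv.le
    obtain ⟨f, rfl⟩ := hsurj a
    have h1 : algebraMap B K (algebraMap A B (Polynomial.aeval xA f)) = Polynomial.aeval x f := by
      change A.val _ = _
      rw [← Polynomial.aeval_algHom_apply]
      rfl
    rw [h1, Polynomial.aeval_eq_sum_range]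
    refine sum_mem fun i _ => ?_
    rw [Algebra.smul_def]
    exact mul_mem (v.algebraMap_mem _) (pow_mem hxv _)
  rw [← hrank]
  exact sum_ord_eq_finrank (B := B) hxB0 hpmax hAv

end CurveField

/-! ### Divisors -/

section Divisors

open IntermediateField

variable {k K : Type*} [Field k] [Field K] [Algebra k K]

theorem divisorDegree_add (D E : Place k K →₀ ℤ) :
    divisorDegree (D + E) = divisorDegree D + divisorDegree E := by
  classical
  exact Finsupp.sum_add_index (by simp) (by simp)

theorem divisorDegree_zero : divisorDegree (0 : Place k K →₀ ℤ) = 0 := Finsupp.sum_zero_index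

theorem divisorDegree_neg (D : Place k K →₀ ℤ) : divisorDegree (-D) = -divisorDegree D := by
  have := divisorDegree_add D (-D)
  rw [add_neg_cancel, divisorDegree_zero] at this
  omega

theorem divisorDegree_single (v : Place k K) (n : ℤ) : divisorDegree (Finsupp.single v n) = n :=
  Finsupp.sum_single_index rfl

theorem divisorDegree_nsmul (n : ℕ) (D : Place k K →₀ ℤ) :
    divisorDegree (n • D) = n * divisorDegree D := by
  induction n with
  | zero => simp [divisorDegree_zero]
  | succ n ih => rw [succ_nsmul, divisorDegree_add, ih]; push_cast; ring

theorem riemannRochSpace_mono {D E : Place k K →₀ ℤ} (h : D ≤ E) :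
    riemannRochSpace D ≤ riemannRochSpace E := by
  intro f hf
  by_cases hf0 : f = 0
  · rw [hf0]
    exact zero_mem _
  · rw [mem_riemannRochSpace_iff hf0] at hf ⊢
    intro v
    have := hf v
    have := h v
    omega

theorem adjoin_inv (x : K) : k⟮x⁻¹⟯ = k⟮x⟯ := by
  apply le_antisymm
  · rw [adjoin_simple_le_iff]
    exact inv_mem (mem_adjoin_simple_self k x)
  · rw [adjoin_simple_le_iff]
    have := inv_mem (mem_adjoin_simple_self k x⁻¹)
    rwa [inv_inv] at this

variable [IsAlgClosed k] [IsCurveField k K]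

/-- Enlarging a divisor by a point adds at most one dimension: two functions in the larger space
have proportional leading terms at that point. -/
theorem riemannRochSpace_add_single_le (D : Place k K →₀ ℤ) (v : Place k K) :
    ∃ g, riemannRochSpace (D + Finsupp.single v 1) ≤ riemannRochSpace D ⊔ Submodule.span k {g} := by
  classical
  by_cases h : riemannRochSpace (D + Finsupp.single v 1) ≤ riemannRochSpace D
  · exact ⟨0, h.trans le_sup_left⟩
  obtain ⟨g, hg, hgD⟩ := SetLike.not_le_iff_exists.1 h
  have hg0 : g ≠ 0 := by
    rintro rfl
    exact hgD (zero_mem _)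
  have hg' := (mem_riemannRochSpace_iff hg0).1 hg
  have hgv : v.ord g = -(D v + 1) := by
    have h1 := hg' v
    rw [Finsupp.add_apply, Finsupp.single_eq_same] at h1
    by_contra hne
    apply hgD
    rw [mem_riemannRochSpace_iff hg0]
    intro w
    by_cases hw : w = v
    · subst hw
      omega
    · have h2 := hg' w
      rw [Finsupp.add_apply, Finsupp.single_eq_of_ne hw] at h2
      omega
  refine ⟨g, fun f hf => ?_⟩
  by_cases hf0 : f = 0
  · rw [hf0]
    exact zero_mem _
  have hf' := (mem_riemannRochSpace_iff hf0).1 hf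
  have hfg : f / g ∈ v.ring := by
    rw [← v.ord_nonneg_iff, div_eq_mul_inv, v.ord_mul hf0 (inv_ne_zero hg0), v.ord_inv, hgv]
    have h1 := hf' v
    rw [Finsupp.add_apply, Finsupp.single_eq_same] at h1
    omega
  obtain ⟨c, hc⟩ := v.exists_sub_algebraMap hfg
  have hsub : f = (f - c • g) + c • g := by ring
  rw [hsub]
  refine Submodule.add_mem_sup ?_ (Submodule.smul_mem _ _ (Submodule.mem_span_singleton_self g))
  by_cases h0 : f - c • g = 0
  · rw [h0]
    exact zero_mem _
  have hmem : f - c • g ∈ riemannRochSpace (D + Finsupp.single v 1) :=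
    sub_mem hf (Submodule.smul_mem _ _ hg)
  have hfac : f - c • g = (f / g - algebraMap k K c) * g := by
    rw [Algebra.smul_def]
    field_simp
  have h1 : 0 < v.ord (f / g - algebraMap k K c) := by
    rcases hc with hc | hc
    · exact absurd (by rw [hfac, hc, sub_self, zero_mul]) h0
    · exact hc
  rw [mem_riemannRochSpace_iff h0] at hmem ⊢
  intro w
  by_cases hw : w = v
  · subst hw
    rw [hfac, w.ord_mul (left_ne_zero_of_mul (hfac ▸ h0)) hg0, hgv]
    omega
  · have h2 := hmem w
    rw [Finsupp.add_apply, Finsupp.single_eq_of_ne hw] at h2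
    omega

theorem finrank_riemannRochSpace_add_single_nat (D : Place k K →₀ ℤ)
    [FiniteDimensional k (riemannRochSpace D)] (v : Place k K) (n : ℕ) :
    FiniteDimensional k (riemannRochSpace (D + Finsupp.single v (n : ℤ))) ∧
    Module.finrank k (riemannRochSpace (D + Finsupp.single v (n : ℤ))) ≤
      Module.finrank k (riemannRochSpace D) + n := by
  induction n with
  | zero =>
    rw [Nat.cast_zero, Finsupp.single_zero, add_zero]
    exact ⟨inferInstance, le_rfl⟩
  | succ n ih =>
    obtain ⟨_, ih⟩ := ih
    obtain ⟨g, hg⟩ := riemannRochSpace_add_single_le (D + Finsupp.single v (n : ℤ)) v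
    rw [add_assoc, ← Finsupp.single_add] at hg
    rw [Nat.cast_succ]
    refine ⟨Submodule.finiteDimensional_of_le hg, (Submodule.finrank_mono hg).trans ?_⟩
    have h1 := Submodule.finrank_add_le_finrank_add_finrank
      (riemannRochSpace (D + Finsupp.single v (n : ℤ))) (Submodule.span k {g})
    have h2 := finrank_span_le_card (R := k) ({g} : Set K)
    rw [Set.toFinset_singleton, Finset.card_singleton] at h2
    omega

theorem finrank_riemannRochSpace_add (D : Place k K →₀ ℤ)
    [FiniteDimensional k (riemannRochSpace D)] (E : Place k K →₀ ℤ) (hE : 0 ≤ E) :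
    FiniteDimensional k (riemannRochSpace (D + E)) ∧
    (Module.finrank k (riemannRochSpace (D + E)) : ℤ) ≤
      Module.finrank k (riemannRochSpace D) + divisorDegree E := by
  classical
  induction E using Finsupp.induction with
  | zero =>
    rw [add_zero, divisorDegree_zero]
    exact ⟨inferInstance, by simp⟩
  | single_add v n E hv hn ih =>
    have hEv : E v = 0 := Finsupp.notMem_support_iff.1 hv
    have hE' : 0 ≤ E := by
      intro w
      by_cases hw : w = v
      · rw [hw, hEv]
        rfl
      · have := hE w
        rwa [Finsupp.add_apply, Finsupp.single_eq_of_ne hw, zero_add] at this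
    have hn0 : 0 ≤ n := by
      have := hE v
      rwa [Finsupp.add_apply, Finsupp.single_eq_same, hEv, add_zero] at this
    lift n to ℕ using hn0
    obtain ⟨_, ih⟩ := ih hE'
    obtain ⟨h1, h2⟩ := finrank_riemannRochSpace_add_single_nat (D + E) v n
    rw [add_comm (Finsupp.single v (n : ℤ)) E, ← add_assoc]
    refine ⟨h1, ?_⟩
    rw [divisorDegree_add, divisorDegree_single]
    omega

variable [CharZero k]

theorem exists_ord_neg {x : K} (hx : x ∉ Set.range (algebraMap k K)) :
    ∃ v : Place k K, v.ord x < 0 := by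
  have hx' : x⁻¹ ∉ Set.range (algebraMap k K) := by
    rintro ⟨c, hc⟩
    exact hx ⟨c⁻¹, by rw [map_inv₀, hc, inv_inv]⟩
  obtain ⟨s, hs, hsum⟩ := sum_ord_zeros hx'
  have := IsCurveField.finiteDimensional x⁻¹ hx'
  have hpos : 0 < Module.finrank k⟮x⁻¹⟯ K := Module.finrank_pos
  obtain ⟨v, hv⟩ : s.Nonempty := by
    by_contra hemp
    rw [Finset.not_nonempty_iff_eq_empty.1 hemp, Finset.sum_empty] at hsum
    omega
  refine ⟨v, ?_⟩
  have := (hs v).1 hv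
  rw [v.ord_inv] at this
  omega

theorem mem_range_of_ord_nonneg {x : K} (hx : ∀ v : Place k K, 0 ≤ v.ord x) :
    x ∈ Set.range (algebraMap k K) := by
  by_contra h
  obtain ⟨v, hv⟩ := exists_ord_neg h
  have := hx v
  omega

theorem riemannRochSpace_zero_le :
    riemannRochSpace (0 : Place k K →₀ ℤ) ≤ Submodule.span k {(1 : K)} := by
  intro f hf
  by_cases hf0 : f = 0
  · rw [hf0]
    exact zero_mem _
  obtain ⟨c, rfl⟩ := mem_range_of_ord_nonneg (x := f) fun v => by
    simpa using (mem_riemannRochSpace_iff hf0).1 hf v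
  exact Submodule.mem_span_singleton.2 ⟨c, by rw [Algebra.smul_def, mul_one]⟩

instance finiteDimensional_riemannRochSpace (D : Place k K →₀ ℤ) :
    FiniteDimensional k (riemannRochSpace D) := by
  have : FiniteDimensional k (riemannRochSpace (0 : Place k K →₀ ℤ)) :=
    Submodule.finiteDimensional_of_le riemannRochSpace_zero_le
  have h := (finrank_riemannRochSpace_add 0 (D ⊔ 0) le_sup_right).1
  rw [zero_add] at h
  exact Submodule.finiteDimensional_of_le (riemannRochSpace_mono (le_sup_left : D ≤ D ⊔ 0))

/-- The function `deg D - ℓ(D)` is monotone in `D`. -/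
theorem divisorDegree_sub_finrank_mono {D E : Place k K →₀ ℤ} (h : D ≤ E) :
    divisorDegree D - Module.finrank k (riemannRochSpace D) ≤
      divisorDegree E - Module.finrank k (riemannRochSpace E) := by
  have h0 : 0 ≤ E - D := by
    intro v
    have := h v
    rw [Finsupp.sub_apply, Finsupp.zero_apply]
    omega
  have h1 := (finrank_riemannRochSpace_add D (E - D) h0).2
  have h2 := divisorDegree_add D (E - D)
  rw [add_sub_cancel] at h1 h2
  omega

theorem finite_ord_ne_zero (f : K) : {v : Place k K | v.ord f ≠ 0}.Finite := by
  by_cases hf : f ∈ Set.range (algebraMap k K)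
  · obtain ⟨c, rfl⟩ := hf
    simp [Place.ord_algebraMap]
  · have hf' : f⁻¹ ∉ Set.range (algebraMap k K) := by
      rintro ⟨c, hc⟩
      exact hf ⟨c⁻¹, by rw [map_inv₀, hc, inv_inv]⟩
    obtain ⟨s, hs, -⟩ := sum_ord_zeros hf
    obtain ⟨t, ht, -⟩ := sum_ord_zeros hf'
    classical
    refine (s ∪ t).finite_toSet.subset fun v hv => ?_
    have hv : v.ord f ≠ 0 := hv
    rw [Finset.mem_coe, Finset.mem_union, hs, ht, v.ord_inv]
    omega

variable (k) in
/-- The divisor of a rational function (and `0` for the zero function). -/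
def principalDivisor (f : K) : Place k K →₀ ℤ :=
  Finsupp.ofSupportFinite (fun v => v.ord f) (finite_ord_ne_zero f)

variable (k) in
/-- The divisor of zeros of a rational function. -/
def zeroDivisor (f : K) : Place k K →₀ ℤ := principalDivisor k f ⊔ 0

variable (k) in
/-- The divisor of poles of a rational function. -/
def poleDivisor (f : K) : Place k K →₀ ℤ := zeroDivisor k f⁻¹

@[simp] theorem principalDivisor_apply (f : K) (v : Place k K) :
    principalDivisor k f v = v.ord f := rfl

@[simp] theorem zeroDivisor_apply (f : K) (v : Place k K) :
    zeroDivisor k f v = max (v.ord f) 0 := rfl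

@[simp] theorem poleDivisor_apply (f : K) (v : Place k K) :
    poleDivisor k f v = max (-v.ord f) 0 := by
  rw [poleDivisor, zeroDivisor_apply, v.ord_inv]

theorem poleDivisor_nonneg (f : K) : 0 ≤ poleDivisor k f := fun v => by
  rw [poleDivisor_apply]
  exact le_max_right _ _

theorem divisorDegree_zeroDivisor {x : K} (hx : x ∉ Set.range (algebraMap k K)) :
    divisorDegree (zeroDivisor k x) = Module.finrank k⟮x⟯ K := by
  obtain ⟨s, hs, hsum⟩ := sum_ord_zeros hx
  rw [← hsum, divisorDegree, Finsupp.sum_of_support_subset (s := s) _ _ _ (by simp)]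
  · refine Finset.sum_congr rfl fun v hv => ?_
    rw [zeroDivisor_apply, max_eq_left ((hs v).1 hv).le]
  · intro v hv
    rw [Finsupp.mem_support_iff, zeroDivisor_apply] at hv
    rw [hs]
    by_contra h
    exact hv (max_eq_right (not_lt.1 h))

theorem divisorDegree_poleDivisor {x : K} (hx : x ∉ Set.range (algebraMap k K)) :
    divisorDegree (poleDivisor k x) = Module.finrank k⟮x⟯ K := by
  have hx' : x⁻¹ ∉ Set.range (algebraMap k K) := by
    rintro ⟨c, hc⟩
    exact hx ⟨c⁻¹, by rw [map_inv₀, hc, inv_inv]⟩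
  rw [poleDivisor, divisorDegree_zeroDivisor hx', adjoin_inv]

theorem principalDivisor_eq_sub (x : K) :
    principalDivisor k x = zeroDivisor k x - poleDivisor k x := by
  ext v
  rw [Finsupp.sub_apply, principalDivisor_apply, zeroDivisor_apply, poleDivisor_apply]
  omega

/-- A rational function has as many zeros as poles. -/
theorem divisorDegree_principalDivisor (x : K) : divisorDegree (principalDivisor k x) = 0 := by
  by_cases hx : x ∈ Set.range (algebraMap k K)
  · obtain ⟨c, rfl⟩ := hx
    have : principalDivisor k (algebraMap k K c) = 0 := by
      ext v
      exact v.ord_algebraMap c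
    rw [this, divisorDegree_zero]
  · rw [principalDivisor_eq_sub, sub_eq_add_neg, divisorDegree_add, divisorDegree_neg,
      divisorDegree_zeroDivisor hx, divisorDegree_poleDivisor hx, add_neg_cancel]

theorem finrank_riemannRochSpace_le_add_principalDivisor (D : Place k K →₀ ℤ) {f : K}
    (hf : f ≠ 0) : Module.finrank k (riemannRochSpace D) ≤
      Module.finrank k (riemannRochSpace (D + principalDivisor k f)) := by
  have hinj : Function.Injective (LinearMap.mulLeft k f⁻¹) :=
    mul_right_injective₀ (inv_ne_zero hf)
  rw [LinearEquiv.finrank_eq (Submodule.equivMapOfInjective _ hinj (riemannRochSpace D))]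
  apply Submodule.finrank_mono
  rintro _ ⟨g, hg, rfl⟩
  rw [LinearMap.mulLeft_apply]
  by_cases hg0 : g = 0
  · simp [hg0]
  rw [mem_riemannRochSpace_iff (mul_ne_zero (inv_ne_zero hf) hg0)]
  intro v
  have := (mem_riemannRochSpace_iff hg0).1 hg v
  rw [v.ord_mul (inv_ne_zero hf) hg0, v.ord_inv, Finsupp.add_apply, principalDivisor_apply]
  omega

/-- Riemann's inequality: a bound for `deg D + 1 - ℓ(D)` along divisors of unbounded degree holds
for all divisors. Every divisor lies below a divisor that is linearly equivalent to one of those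
of large degree. -/
theorem genus_le_of_unbounded (g : ℕ) (H : ∀ N : ℤ, ∃ D : Place k K →₀ ℤ, N ≤ divisorDegree D ∧
    divisorDegree D + 1 - Module.finrank k (riemannRochSpace D) ≤ g) : genus k K ≤ g := by
  refine iSup_le fun D => ?_
  rw [Nat.cast_le, Int.toNat_le]
  set E := D ⊔ 0
  have hE0 : 0 ≤ E := le_sup_right
  obtain ⟨M, hM, hMg⟩ := H (divisorDegree E + g)
  have h1 : M - E ≤ M := by
    intro v
    have := hE0 v
    rw [Finsupp.zero_apply] at this
    rw [Finsupp.sub_apply]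
    omega
  have h2 := divisorDegree_sub_finrank_mono h1
  have h3 := divisorDegree_add M (-E)
  rw [divisorDegree_neg, ← sub_eq_add_neg] at h3
  have h4 : 0 < Module.finrank k (riemannRochSpace (M - E)) := by omega
  obtain ⟨⟨f, hf⟩, hf0⟩ := (Module.finrank_pos_iff_exists_ne_zero (R := k)).1 h4
  have hf0 : f ≠ 0 := fun h => hf0 (Subtype.ext h)
  have h5 : D ≤ M + principalDivisor k f := by
    refine (le_sup_left : D ≤ E).trans fun v => ?_
    have := (mem_riemannRochSpace_iff hf0).1 hf v
    rw [Finsupp.sub_apply] at this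
    rw [Finsupp.add_apply, principalDivisor_apply]
    change E v ≤ _
    omega
  have h6 := divisorDegree_sub_finrank_mono h5
  rw [divisorDegree_add, divisorDegree_principalDivisor] at h6
  have h7 := finrank_riemannRochSpace_le_add_principalDivisor M hf0
  omega

/-- On a curve of genus zero, a function all of whose zeros and poles have even order is a
square. -/
theorem isSquare_of_even_ord (hg : genus k K = 0) {h : K} (hh : h ≠ 0)
    (heven : ∀ v : Place k K, Even (v.ord h)) : IsSquare h := by
  have hfin : (Function.support fun v : Place k K => v.ord h / 2).Finite := by
    refine (finite_ord_ne_zero h).subset fun v hv h0 => hv ?_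
    change v.ord h / 2 = 0
    rw [h0, Int.zero_ediv]
  set E : Place k K →₀ ℤ := Finsupp.ofSupportFinite _ hfin
  have hEv : ∀ v, 2 * E v = v.ord h := fun v => Int.two_mul_ediv_two_of_even (heven v)
  have hdeg : divisorDegree E = 0 := by
    have h1 : E + E = principalDivisor k h := by
      ext v
      rw [Finsupp.add_apply, ← two_mul, hEv, principalDivisor_apply]
    have h2 := divisorDegree_add E E
    rw [h1, divisorDegree_principalDivisor] at h2
    omega
  have hpos : 0 < Module.finrank k (riemannRochSpace E) := by
    have h1 := (le_iSup (fun D : Place k K →₀ ℤ =>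
      (((divisorDegree D + 1 - (Module.finrank k (riemannRochSpace D) : ℤ)).toNat : ℕ) : ℕ∞))
        E).trans hg.le
    rw [hdeg] at h1
    have h2 : (0 + 1 - (Module.finrank k (riemannRochSpace E) : ℤ)).toNat = 0 := by
      exact_mod_cast nonpos_iff_eq_zero.1 h1
    omega
  obtain ⟨⟨f, hf⟩, hf0⟩ := (Module.finrank_pos_iff_exists_ne_zero (R := k)).1 hpos
  have hf0 : f ≠ 0 := fun h => hf0 (Subtype.ext h)
  obtain ⟨c, hc⟩ := mem_range_of_ord_nonneg (k := k) (x := h * f ^ 2) fun v => by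
    have := (mem_riemannRochSpace_iff hf0).1 hf v
    rw [v.ord_mul hh (pow_ne_zero 2 hf0), v.ord_pow, ← hEv]
    push_cast
    omega
  obtain ⟨d, hd⟩ := IsAlgClosed.exists_pow_nat_eq c (n := 2) two_pos
  refine ⟨algebraMap k K d / f, ?_⟩
  rw [← hd, map_pow] at hc
  field_simp
  exact hc.symm

end Divisors

/-! ### Curves with two functions of small degree -/

section SmallDegree

open IntermediateField

variable {k K : Type*} [Field k] [Field K] [Algebra k K]

theorem linearIndependent_pow_of_transcendental {x : K} (hx : Transcendental k x) :
    LinearIndependent k fun i : ℕ => x ^ i := by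
  have h := (Polynomial.basisMonomials k).linearIndependent.map'
    (Polynomial.aeval x).toLinearMap (LinearMap.ker_eq_bot.2 (transcendental_iff_injective.1 hx))
  have heq : (fun i : ℕ => x ^ i) =
      (Polynomial.aeval x).toLinearMap ∘ Polynomial.basisMonomials k := by
    funext i
    simp [Polynomial.aeval_monomial]
  rw [heq]
  exact h

theorem finrank_adjoin_eq_one_iff (x : K) : Module.finrank k⟮x⟯ K = 1 ↔ k⟮x⟯ = ⊤ := by
  rw [IntermediateField.finrank_eq_one_iff_eq_top]

theorem adjoin_pair_eq_of_mem {u v : K} (hv : v ∈ k⟮u⟯) : adjoin k {u, v} = k⟮u⟯ := by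
  apply le_antisymm
  · rw [adjoin_le_iff]
    rintro x (rfl | rfl)
    · exact mem_adjoin_simple_self k x
    · exact hv
  · exact adjoin.mono k _ _ (by simp)

theorem adjoin_sub_algebraMap (u : K) (t : k) : k⟮u - algebraMap k K t⟯ = k⟮u⟯ := by
  apply le_antisymm
  · rw [adjoin_simple_le_iff]
    exact sub_mem (mem_adjoin_simple_self k u) (_root_.algebraMap_mem _ t)
  · rw [adjoin_simple_le_iff]
    have := add_mem (mem_adjoin_simple_self k (u - algebraMap k K t))
      (_root_.algebraMap_mem k⟮u - algebraMap k K t⟯ t)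
    rwa [sub_add_cancel] at this

theorem sub_algebraMap_notMem_range {u : K} (hu : u ∉ Set.range (algebraMap k K)) (t : k) :
    u - algebraMap k K t ∉ Set.range (algebraMap k K) := by
  rintro ⟨c, hc⟩
  exact hu ⟨c + t, by rw [map_add, hc, sub_add_cancel]⟩

/-- If `y` generates `K` over `k(x)` and is a root of a nonzero polynomial of degree at most `d`,
then `[K : k(x)] ≤ d`. -/
theorem finrank_le_of_root {x y : K} (hxy : adjoin k {x, y} = ⊤) {p : Polynomial k⟮x⟯} (hp : p ≠ 0)
    {d : ℕ} (hd : p.natDegree ≤ d) (hroot : Polynomial.aeval y p = 0) :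
    FiniteDimensional k⟮x⟯ K ∧ Module.finrank k⟮x⟯ K ≤ d := by
  have hint : IsIntegral k⟮x⟯ y := IsAlgebraic.isIntegral ⟨p, hp, hroot⟩
  have htop : (k⟮x⟯⟮y⟯) = ⊤ := by
    apply restrictScalars_injective k
    rw [adjoin_simple_adjoin_simple, hxy]
    rfl
  have h1 := adjoin.finrank hint
  have h2 := adjoin.finiteDimensional hint
  rw [htop] at h2
  rw [htop, finrank_top'] at h1
  rw [h1]
  refine ⟨LinearEquiv.finiteDimensional topEquiv.toLinearEquiv, ?_⟩
  exact (Polynomial.natDegree_le_natDegree (minpoly.degree_le_of_ne_zero _ y hp hroot)).trans hd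

theorem one_mem_riemannRochSpace {E : Place k K →₀ ℤ} (hE : 0 ≤ E) : 1 ∈ riemannRochSpace E := by
  rw [mem_riemannRochSpace_iff one_ne_zero]
  intro v
  have := hE v
  rw [Finsupp.zero_apply] at this
  rw [v.ord_one]
  omega

theorem subsingleton_setOf_ord_sub_pos (v : Place k K) (u : K)
    (hu : u ∉ Set.range (algebraMap k K)) :
    {t : k | 0 < v.ord (u - algebraMap k K t)}.Subsingleton := by
  intro s hs t ht
  have hs : 0 < v.ord (u - algebraMap k K s) := hs
  have ht : 0 < v.ord (u - algebraMap k K t) := ht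
  by_contra hst
  have heq : (u - algebraMap k K s) + -(u - algebraMap k K t) = algebraMap k K (t - s) := by
    rw [map_sub]
    ring
  have h0 : algebraMap k K (t - s) ≠ 0 := by
    exact (map_ne_zero _).2 (sub_ne_zero.2 (Ne.symm hst))
  have h1 : 1 ≤ v.ord (algebraMap k K (t - s)) := by
    rw [← heq] at h0 ⊢
    refine v.le_ord_add h0 (fun _ => hs) fun _ => ?_
    have hneg : -(u - algebraMap k K t) = algebraMap k K (-1) * (u - algebraMap k K t) := by simp
    rw [hneg, v.ord_mul (by simp)
      (fun h => sub_algebraMap_notMem_range hu t ⟨0, by rw [h, map_zero]⟩), v.ord_algebraMap]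
    omega
  rw [v.ord_algebraMap] at h1
  omega

variable [IsAlgClosed k] [IsCurveField k K] [CharZero k]

/-- If `w` is linearly independent over `k(u)` and contained in `L(E)`, then the products
`u ^ i * w j` with `i ≤ n` are linearly independent elements of `L(n (u)_∞ + E)`. -/
theorem le_finrank_riemannRochSpace {u : K} (hu : u ∉ Set.range (algebraMap k K)) {ι : Type*}
    [Fintype ι] {w : ι → K} (hw : LinearIndependent k⟮u⟯ w) {E : Place k K →₀ ℤ}
    (hwE : ∀ i, w i ∈ riemannRochSpace E) (n : ℕ) :
    (n + 1) * Fintype.card ι ≤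
      Module.finrank k (riemannRochSpace (n • poleDivisor k u + E)) := by
  have htr := transcendental_of_notMem_range hu
  have hgen : Transcendental k (AdjoinSimple.gen k u) := by
    intro h
    apply htr
    have := h.algebraMap (A := K)
    simpa using this
  have hpow : LinearIndependent k fun i : Fin (n + 1) => AdjoinSimple.gen k u ^ (i : ℕ) :=
    (linearIndependent_pow_of_transcendental hgen).comp _ Fin.val_injective
  have hli := linearIndependent_smul hpow hw
  have hu0 : u ≠ 0 := by
    rintro rfl
    exact hu ⟨0, map_zero _⟩
  have hmem : ∀ q : Fin (n + 1) × ι, (AdjoinSimple.gen k u ^ (q.1 : ℕ)) • w q.2 ∈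
      riemannRochSpace (n • poleDivisor k u + E) := by
    rintro ⟨i, j⟩
    have hw0 := hw.ne_zero j
    have heq : (AdjoinSimple.gen k u ^ (i : ℕ)) • w j = u ^ (i : ℕ) * w j := rfl
    rw [heq, mem_riemannRochSpace_iff (mul_ne_zero (pow_ne_zero _ hu0) hw0)]
    intro v
    have h1 := (mem_riemannRochSpace_iff hw0).1 (hwE j) v
    rw [v.ord_mul (pow_ne_zero _ hu0) hw0, v.ord_pow, Finsupp.add_apply, Finsupp.smul_apply,
      poleDivisor_apply, nsmul_eq_mul]
    have h2 : ((i : ℕ) : ℤ) ≤ n := by exact_mod_cast Nat.lt_succ_iff.1 i.2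
    have h3 : -(((i : ℕ) : ℤ) * v.ord u) ≤ n * max (-v.ord u) 0 := by
      calc -(((i : ℕ) : ℤ) * v.ord u) = ((i : ℕ) : ℤ) * (-v.ord u) := by ring
        _ ≤ ((i : ℕ) : ℤ) * max (-v.ord u) 0 := by gcongr; exact le_max_left _ _
        _ ≤ n * max (-v.ord u) 0 := by gcongr
    linarith
  have hli' : LinearIndependent k fun q : Fin (n + 1) × ι =>
      (⟨_, hmem q⟩ : riemannRochSpace (n • poleDivisor k u + E)) :=
    LinearIndependent.of_comp (Submodule.subtype _) hli
  simpa using hli'.fintype_card_le_finrank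

theorem mem_riemannRochSpace_poleDivisor (f : K) : f ∈ riemannRochSpace (poleDivisor k f) := by
  by_cases hf : f = 0
  · rw [hf]
    exact zero_mem _
  · rw [mem_riemannRochSpace_iff hf]
    intro v
    rw [poleDivisor_apply]
    omega

/-- A rational curve has genus zero; the bound `1` is what is needed below. -/
theorem genus_le_one_of_adjoin_eq_top {u : K} (hu : u ∉ Set.range (algebraMap k K))
    (htop : k⟮u⟯ = ⊤) : genus k K ≤ 1 := by
  refine genus_le_of_unbounded 1 fun N => ⟨N.toNat • poleDivisor k u + 0, ?_, ?_⟩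
  all_goals
    rw [add_zero, divisorDegree_nsmul, divisorDegree_poleDivisor hu,
      (finrank_adjoin_eq_one_iff u).2 htop]
  · have := Int.self_le_toNat N
    push_cast
    linarith
  · have h := le_finrank_riemannRochSpace hu (ι := Unit) (w := fun _ => (1 : K)) (E := 0)
      (LinearIndependent.of_subsingleton () one_ne_zero)
      (fun _ => one_mem_riemannRochSpace le_rfl) N.toNat
    rw [add_zero] at h
    simp only [Fintype.card_unit, mul_one] at h
    push_cast
    omega

/-- The field `K = k(u, v)` with `[K : k(u)] + [K : k(v)] ≤ 4` has genus at most one: it is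
rational, or `K` has degree two over both `k(u)` and `k(v)`, and then `1, v` are linearly
independent over `k(u)`. -/
theorem genus_le_one_of_finrank_add_le {u v : K} (htop : adjoin k {u, v} = ⊤)
    (hu : u ∉ Set.range (algebraMap k K)) (hv : v ∉ Set.range (algebraMap k K))
    (h4 : Module.finrank k⟮u⟯ K + Module.finrank k⟮v⟯ K ≤ 4) : genus k K ≤ 1 := by
  have := IsCurveField.finiteDimensional u hu
  have := IsCurveField.finiteDimensional v hv
  have hup : 0 < Module.finrank k⟮u⟯ K := Module.finrank_pos
  have hvp : 0 < Module.finrank k⟮v⟯ K := Module.finrank_pos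
  by_cases hu1 : k⟮u⟯ = ⊤
  · exact genus_le_one_of_adjoin_eq_top hu hu1
  by_cases hv1 : k⟮v⟯ = ⊤
  · exact genus_le_one_of_adjoin_eq_top hv hv1
  have hu1' := mt (finrank_adjoin_eq_one_iff u).1 hu1
  have hv1' := mt (finrank_adjoin_eq_one_iff v).1 hv1
  have hvu : v ∉ k⟮u⟯ := fun h => hu1 (by rw [← adjoin_pair_eq_of_mem h, htop])
  have hli : LinearIndependent k⟮u⟯ ![(1 : K), v] := by
    rw [LinearIndependent.pair_iff' one_ne_zero]
    intro a ha
    apply hvu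
    rw [← ha, Algebra.smul_def, mul_one]
    exact a.2
  have hmem : ∀ i, ![(1 : K), v] i ∈ riemannRochSpace (poleDivisor k v) := by
    intro i
    fin_cases i
    · exact one_mem_riemannRochSpace (poleDivisor_nonneg v)
    · exact mem_riemannRochSpace_poleDivisor v
  have hu2 : Module.finrank k⟮u⟯ K = 2 := by omega
  have hv2 : Module.finrank k⟮v⟯ K = 2 := by omega
  refine genus_le_of_unbounded 1 fun N => ⟨N.toNat • poleDivisor k u + poleDivisor k v, ?_, ?_⟩
  all_goals
    rw [divisorDegree_add, divisorDegree_nsmul, divisorDegree_poleDivisor hu,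
      divisorDegree_poleDivisor hv, hu2, hv2]
  · have := Int.self_le_toNat N
    push_cast
    linarith [Int.natCast_nonneg N.toNat]
  · have h := le_finrank_riemannRochSpace hu hli hmem N.toNat
    rw [Fintype.card_fin] at h
    push_cast
    omega

/-- For general `t`, no zero of `u - t` is a pole of `v - t` or conversely, so the degree of
`(u - t) * (v - t)` is the sum of the degrees of `u` and `v`. -/
theorem exists_finrank_mul_eq_add {u v : K} (hu : u ∉ Set.range (algebraMap k K))
    (hv : v ∉ Set.range (algebraMap k K)) :
    ∃ t : k, (u - algebraMap k K t) * (v - algebraMap k K t) ∉ Set.range (algebraMap k K) ∧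
      Module.finrank k⟮(u - algebraMap k K t) * (v - algebraMap k K t)⟯ K =
        Module.finrank k⟮u⟯ K + Module.finrank k⟮v⟯ K := by
  have hbad : ∀ a b : K, a ∉ Set.range (algebraMap k K) →
      {t : k | ∃ w : Place k K, w.ord b ≠ 0 ∧ 0 < w.ord (a - algebraMap k K t)}.Finite := by
    intro a b ha
    have : {t : k | ∃ w : Place k K, w.ord b ≠ 0 ∧ 0 < w.ord (a - algebraMap k K t)} =
        ⋃ w ∈ {w : Place k K | w.ord b ≠ 0}, {t : k | 0 < w.ord (a - algebraMap k K t)} := by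
      ext t
      simp
    rw [this]
    exact (finite_ord_ne_zero b).biUnion fun w _ => (subsingleton_setOf_ord_sub_pos w a ha).finite
  obtain ⟨t, ht⟩ := ((hbad u v hu).union (hbad v u hv)).exists_notMem
  rw [Set.mem_union, not_or] at ht
  obtain ⟨ht1, ht2⟩ := ht
  have hu' := sub_algebraMap_notMem_range hu t
  have hv' := sub_algebraMap_notMem_range hv t
  have hu0 : u - algebraMap k K t ≠ 0 := fun h => hu' ⟨0, by rw [h, map_zero]⟩
  have hv0 : v - algebraMap k K t ≠ 0 := fun h => hv' ⟨0, by rw [h, map_zero]⟩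
  have hpole : ∀ (w : Place k K) (a : K), w.ord (a - algebraMap k K t) < 0 → w.ord a ≠ 0 := by
    intro w a h h0
    have h1 := w.ord_nonneg_iff.2 (sub_mem (w.ord_nonneg_iff.1 h0.ge) (w.algebraMap_mem t))
    omega
  have hz : zeroDivisor k ((u - algebraMap k K t) * (v - algebraMap k K t)) =
      zeroDivisor k (u - algebraMap k K t) + zeroDivisor k (v - algebraMap k K t) := by
    ext w
    rw [Finsupp.add_apply, zeroDivisor_apply, zeroDivisor_apply, zeroDivisor_apply,
      w.ord_mul hu0 hv0]
    have h1 : 0 < w.ord (u - algebraMap k K t) → 0 ≤ w.ord (v - algebraMap k K t) := by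
      intro h
      by_contra! h'
      exact ht1 ⟨w, hpole w v h', h⟩
    have h2 : 0 < w.ord (v - algebraMap k K t) → 0 ≤ w.ord (u - algebraMap k K t) := by
      intro h
      by_contra! h'
      exact ht2 ⟨w, hpole w u h', h⟩
    omega
  have hdeg := congrArg divisorDegree hz
  rw [divisorDegree_add, divisorDegree_zeroDivisor hu', divisorDegree_zeroDivisor hv',
    adjoin_sub_algebraMap, adjoin_sub_algebraMap] at hdeg
  have := IsCurveField.finiteDimensional u hu
  have hup : 0 < Module.finrank k⟮u⟯ K := Module.finrank_pos
  have hnc : (u - algebraMap k K t) * (v - algebraMap k K t) ∉ Set.range (algebraMap k K) := by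
    rintro ⟨c, hc⟩
    have h0 : zeroDivisor k ((u - algebraMap k K t) * (v - algebraMap k K t)) = 0 := by
      ext w
      rw [← hc, zeroDivisor_apply, w.ord_algebraMap, max_self, Finsupp.zero_apply]
    rw [h0, divisorDegree_zero] at hdeg
    omega
  rw [divisorDegree_zeroDivisor hnc] at hdeg
  exact ⟨t, hnc, by exact_mod_cast hdeg⟩

end SmallDegree

/-! ### Homogeneous coordinates on a plane curve -/

theorem aeval_mul_of_isHomogeneous {σ R A : Type*} [Fintype σ] [CommRing R] [CommRing A]
    [Algebra R A] {F : MvPolynomial σ R} {n : ℕ} (hF : F.IsHomogeneous n) (s : A) (y : σ → A) :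
    aeval (fun j => s * y j) F = s ^ n * aeval y F := by
  rw [aeval_def, aeval_def, eval₂_eq', eval₂_eq', Finset.mul_sum]
  refine Finset.sum_congr rfl fun m hm => ?_
  have hdeg : ∑ i, m i = n := by
    have h := hF (mem_support_iff.1 hm)
    rw [← h, Finsupp.weight_apply, Finsupp.sum_fintype _ _ (by simp)]
    simp
  simp only [mul_pow]
  rw [Finset.prod_mul_distrib, Finset.prod_pow_eq_pow_sum, hdeg]
  ring

theorem eval_mul_of_isHomogeneous {σ R : Type*} [Fintype σ] [CommRing R]
    {F : MvPolynomial σ R} {n : ℕ} (hF : F.IsHomogeneous n) (s : R) (y : σ → R) :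
    eval (fun j => s * y j) F = s ^ n * eval y F := by
  have := aeval_mul_of_isHomogeneous hF s y
  simpa [aeval_eq_eval] using this

/-- Let `q` be a form and let `α + β r + γ s` parametrize the affine plane `c ≠ 0` (where `c` is a
linear form). If `q` vanishes at `α + β g + γ y` with `g` transcendental, this gives a nontrivial
equation of degree at most `deg q` for `y` over a field `F` that contains `g`. -/
theorem exists_root_of_isHomogeneous {k F K : Type*} [Field k] [Infinite k] [Field F] [Field K]
    [Algebra k F] [Algebra F K] [Algebra k K] [IsScalarTower k F K] {q c : MvPolynomial (Fin 3) k}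
    {d : ℕ} (hq : q.IsHomogeneous d) (hq0 : q ≠ 0) (hc0 : c ≠ 0) {g : F} (hg : Transcendental k g)
    {y : K} {α β γ : Fin 3 → k}
    (hroot : aeval (fun j => algebraMap k K (α j) + algebraMap k K (β j) * algebraMap F K g +
      algebraMap k K (γ j) * y) q = 0)
    (hspan : ∀ p, eval p c ≠ 0 → ∃ r s : k, p = fun j => eval p c * (α j + β j * r + γ j * s)) :
    ∃ p : Polynomial F, p ≠ 0 ∧ p.natDegree ≤ d ∧ Polynomial.aeval y p = 0 := by
  let l : Fin 3 → Polynomial F := fun j =>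
    Polynomial.C (algebraMap k F (α j) + algebraMap k F (β j) * g) +
      Polynomial.C (algebraMap k F (γ j)) * Polynomial.X
  refine ⟨aeval l q, ?_, ?_, ?_⟩
  · intro h0
    have h1 : ∀ r s : k, eval (fun j => α j + β j * r + γ j * s) q = 0 := by
      intro r s
      let m : Fin 3 → Polynomial k := fun j =>
        Polynomial.C (α j + γ j * s) + Polynomial.C (β j) * Polynomial.X
      have h2 : aeval m q = 0 := by
        apply transcendental_iff.1 hg
        have h3 := congrArg ((Polynomial.aeval (R := F) (algebraMap k F s)).restrictScalars k) h0
        rw [map_zero, ← AlgHom.comp_apply, comp_aeval] at h3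
        rw [← AlgHom.comp_apply, comp_aeval, ← h3]
        congr 2
        funext j
        simp only [m, l, AlgHom.coe_restrictScalars', map_add, map_mul, Polynomial.aeval_C,
          Polynomial.aeval_X, Algebra.algebraMap_self, RingHom.id_apply]
        ring
      have h4 := congrArg (Polynomial.aeval r) h2
      rw [map_zero, ← AlgHom.comp_apply, comp_aeval, aeval_eq_eval] at h4
      rw [← h4]
      congr 2
      funext j
      simp only [m, map_add, map_mul, Polynomial.aeval_C,
        Polynomial.aeval_X, Algebra.algebraMap_self, RingHom.id_apply]
      ring
    have h5 : c * q = 0 := by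
      refine MvPolynomial.funext fun p => ?_
      rw [map_mul, map_zero]
      by_cases hp : eval p c = 0
      · rw [hp, zero_mul]
      · obtain ⟨r, s, hrs⟩ := hspan p hp
        have h6 : eval p q = 0 := by
          rw [hrs, eval_mul_of_isHomogeneous hq, h1, mul_zero]
        rw [h6, mul_zero]
    rcases mul_eq_zero.1 h5 with h | h
    · exact hc0 h
    · exact hq0 h
  · have hl : ∀ j, (l j).natDegree ≤ 1 := by
      intro j
      simp only [l]
      compute_degree
    rw [← aeval_map_algebraMap F, ← mul_one d]
    exact aeval_natDegree_le _ (hq.map _).totalDegree_le l hl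
  · have h3 : Polynomial.aeval y (aeval l q) =
        ((Polynomial.aeval (R := F) y).restrictScalars k).comp (aeval l) q := rfl
    rw [h3, comp_aeval, ← hroot]
    congr 2
    funext j
    simp only [l, AlgHom.coe_restrictScalars', map_add, map_mul, Polynomial.aeval_C,
      Polynomial.aeval_X, ← IsScalarTower.algebraMap_apply]

namespace IrreduciblePlaneCurve

open IntermediateField

variable {d : ℕ} (Q : IrreduciblePlaneCurve d)

/-- The restriction of polynomials to the affine cone over the curve, with values in the fraction
field of the homogeneous coordinate ring. -/
def toFrac : PlanePoly →ₐ[ℂ] FractionRing Q.coordinateRing :=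
  (IsScalarTower.toAlgHom ℂ Q.coordinateRing (FractionRing Q.coordinateRing)).comp
    (Ideal.Quotient.mkₐ ℂ (Ideal.span {Q.form}))

theorem toFrac_apply (a : PlanePoly) : Q.toFrac a =
    algebraMap Q.coordinateRing (FractionRing Q.coordinateRing) (Ideal.Quotient.mk _ a) := rfl

theorem toFrac_eq_zero_iff {a : PlanePoly} : Q.toFrac a = 0 ↔ Q.form ∣ a := by
  rw [toFrac_apply, FaithfulSMul.algebraMap_eq_zero_iff, Ideal.Quotient.eq_zero_iff_dvd]

theorem exists_forms_of_mem_functionField {f : FractionRing Q.coordinateRing}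
    (hf : f ∈ Q.functionField) : ∃ (n : ℕ) (a b : PlanePoly), a.IsHomogeneous n ∧
      b.IsHomogeneous n ∧ Q.toFrac b ≠ 0 ∧ f = Q.toFrac a / Q.toFrac b := by
  induction hf using adjoin_induction with
  | mem f hf =>
    obtain ⟨n, a, b, ha, hb, rfl⟩ := hf
    by_cases h : Q.toFrac b = 0
    · refine ⟨0, 0, 1, isHomogeneous_zero _ _ _, isHomogeneous_one _ _, by simp, ?_⟩
      rw [← toFrac_apply, ← toFrac_apply, h]
      simp
    · exact ⟨n, a, b, ha, hb, h, rfl⟩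
  | algebraMap c =>
    refine ⟨0, C c, 1, isHomogeneous_C _ _, isHomogeneous_one _ _, by simp, ?_⟩
    rw [map_one, div_one, ← algebraMap_eq, AlgHom.commutes]
  | add f g _ _ hf hg =>
    obtain ⟨n, a, b, ha, hb, hb0, rfl⟩ := hf
    obtain ⟨m, a', b', ha', hb', hb0', rfl⟩ := hg
    refine ⟨n + m, a * b' + b * a', b * b', (ha.mul hb').add (hb.mul ha'), hb.mul hb', ?_, ?_⟩
    · rw [map_mul]
      exact mul_ne_zero hb0 hb0'
    · rw [div_add_div _ _ hb0 hb0', map_add, map_mul, map_mul, map_mul]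
  | inv f _ hf =>
    obtain ⟨n, a, b, ha, hb, hb0, rfl⟩ := hf
    by_cases h : Q.toFrac a = 0
    · refine ⟨0, 0, 1, isHomogeneous_zero _ _ _, isHomogeneous_one _ _, by simp, ?_⟩
      rw [h]
      simp
    · exact ⟨n, b, a, hb, ha, h, by rw [inv_div]⟩
  | mul f g _ _ hf hg =>
    obtain ⟨n, a, b, ha, hb, hb0, rfl⟩ := hf
    obtain ⟨m, a', b', ha', hb', hb0', rfl⟩ := hg
    refine ⟨n + m, a * a', b * b', ha.mul ha', hb.mul hb', ?_, ?_⟩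
    · rw [map_mul]
      exact mul_ne_zero hb0 hb0'
    · rw [div_mul_div_comm, map_mul, map_mul]

variable {c : PlanePoly} (hc : c.IsHomogeneous 1)

/-- The rational function `x_j / c` on the curve, for a linear form `c`. -/
def coord (j : Fin 3) : Q.functionField :=
  ⟨Q.toFrac (X j) / Q.toFrac c,
    subset_adjoin _ _ ⟨1, X j, c, isHomogeneous_X _ _, hc, rfl⟩⟩

theorem coe_aeval_coord {n : ℕ} {a : PlanePoly} (ha : a.IsHomogeneous n) :
    ((aeval (Q.coord hc) a : Q.functionField) : FractionRing Q.coordinateRing) =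
      Q.toFrac a / Q.toFrac c ^ n := by
  have h1 : ((aeval (Q.coord hc) a : Q.functionField) : FractionRing Q.coordinateRing) =
      aeval (fun j => (Q.toFrac c)⁻¹ * Q.toFrac (X j)) a := by
    rw [← IntermediateField.coe_val, ← AlgHom.comp_apply, comp_aeval]
    congr 2
    funext j
    exact div_eq_inv_mul _ _
  have h2 : aeval (fun j => Q.toFrac (X j)) a = Q.toFrac a := by
    rw [← comp_aeval_apply, aeval_X_left_apply]
  rw [h1, aeval_mul_of_isHomogeneous ha, h2, inv_pow, div_eq_inv_mul]

variable (hc0 : Q.toFrac c ≠ 0)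

include hc0 in
theorem aeval_coord_eq_zero_iff {n : ℕ} {a : PlanePoly} (ha : a.IsHomogeneous n) :
    aeval (Q.coord hc) a = 0 ↔ Q.form ∣ a := by
  rw [← Q.toFrac_eq_zero_iff, ← ZeroMemClass.coe_eq_zero, Q.coe_aeval_coord hc ha]
  simp [hc0]

include hc0 in
theorem aeval_coord_self : aeval (Q.coord hc) c = 1 := by
  apply Subtype.ext
  rw [Q.coe_aeval_coord hc hc, pow_one, div_self hc0]
  rfl

include hc0 in
theorem exists_forms (f : Q.functionField) : ∃ (n : ℕ) (a b : PlanePoly), a.IsHomogeneous n ∧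
    b.IsHomogeneous n ∧ aeval (Q.coord hc) b ≠ 0 ∧
      f = aeval (Q.coord hc) a / aeval (Q.coord hc) b := by
  obtain ⟨n, a, b, ha, hb, hb0, h⟩ := Q.exists_forms_of_mem_functionField f.2
  refine ⟨n, a, b, ha, hb, ?_, Subtype.ext ?_⟩
  · rw [Ne, Q.aeval_coord_eq_zero_iff hc hc0 hb, ← toFrac_eq_zero_iff]
    exact hb0
  · rw [h]
    push_cast
    rw [Q.coe_aeval_coord hc ha, Q.coe_aeval_coord hc hb]
    field_simp

include hc0 in
theorem adjoin_coord_eq_top : adjoin ℂ (Set.range (Q.coord hc)) = ⊤ := by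
  rw [eq_top_iff]
  intro f _
  obtain ⟨n, a, b, -, -, -, rfl⟩ := Q.exists_forms hc hc0 f
  have key : ∀ a : PlanePoly, aeval (Q.coord hc) a ∈ adjoin ℂ (Set.range (Q.coord hc)) := by
    intro a
    apply algebra_adjoin_le_adjoin
    rw [Algebra.adjoin_range_eq_range_aeval]
    exact ⟨a, rfl⟩
  exact div_mem (key a) (key b)

/-- An intermediate field over which the coordinates are defined is everything. -/
theorem eq_top_of_coord_mem (hc0 : Q.toFrac c ≠ 0) {F : IntermediateField ℂ Q.functionField}
    (h : ∀ j, Q.coord hc j ∈ F) : F = ⊤ := by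
  rw [eq_top_iff, ← Q.adjoin_coord_eq_top hc hc0, adjoin_le_iff]
  rintro _ ⟨j, rfl⟩
  exact h j

end IrreduciblePlaneCurve

/-! ### The function field of a plane curve has one variable -/

namespace IrreduciblePlaneCurve

open IntermediateField

variable {d : ℕ} (Q : IrreduciblePlaneCurve d)

theorem exists_toFrac_X_ne_zero : ∃ i : Fin 3, Q.toFrac (X i) ≠ 0 := by
  by_contra! h
  have h0 := Q.toFrac_eq_zero_iff.1 (h 0)
  have h1 := Q.toFrac_eq_zero_iff.1 (h 1)
  have hX : Irreducible (X 0 : PlanePoly) := (X_prime (σ := Fin 3) (i := 0)).irreducible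
  have hass : Associated Q.form (X 0) := (Q.irreducible.dvd_irreducible_iff_associated hX).1 h0
  have := (hass.symm.dvd.trans h1)
  rw [X_dvd_X] at this
  exact absurd this (by simp)

open scoped IntermediateField.algebraAdjoinAdjoin in
/-- If `K` is finitely generated over `k` and finite over `k(N)`, it is finite over `k(x)` for
every nonconstant `x`: both `N` and `x` are transcendence bases. -/
theorem _root_.QuarticConic.isCurveField_of_finiteDimensional {k K : Type*} [Field k] [Field K]
    [Algebra k K] [IsAlgClosed k] {s : Set K} (hs : s.Finite) (htop : adjoin k s = ⊤) {N : K}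
    (hN : FiniteDimensional k⟮N⟯ K) : IsCurveField k K := by
  refine ⟨fun x hx => ?_⟩
  have hxt := transcendental_of_notMem_range hx
  have h1 : Algebra.IsAlgebraic (Algebra.adjoin k {N}) K :=
    Algebra.IsAlgebraic.trans (Algebra.adjoin k {N}) k⟮N⟯ K
  have h2 : Algebra.trdeg k K ≤ 1 := by
    have := Algebra.IsAlgebraic.trdeg_le_cardinalMk k ({N} : Set K)
    rwa [Cardinal.mk_singleton] at this
  have h3 : AlgebraicIndependent k fun _ : Unit => x :=
    (algebraicIndependent_unique_type_iff).2 hxt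
  have h4 : IsTranscendenceBasis k fun _ : Unit => x := by
    refine h3.isTranscendenceBasis_of_lift_trdeg_le_of_finite ?_
    simpa using h2
  have h5 : Algebra.IsAlgebraic k⟮x⟯ K := by
    have := h4.isAlgebraic_field
    rwa [Set.range_const] at this
  have h6 : adjoin k⟮x⟯ s = ⊤ := by
    rw [eq_top_iff]
    intro f _
    have : f ∈ adjoin k s := htop ▸ mem_top
    exact (adjoin_le_iff.2 (subset_adjoin k⟮x⟯ s) :
      adjoin k s ≤ (adjoin k⟮x⟯ s).restrictScalars k) this
  have := hs.to_subtype
  have h7 : FiniteDimensional k⟮x⟯ (adjoin k⟮x⟯ s) :=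
    finiteDimensional_adjoin fun y _ => Algebra.IsIntegral.isIntegral y
  rw [h6] at h7
  exact LinearEquiv.finiteDimensional topEquiv.toLinearEquiv

/-- Some quotient `x_j / x_i` is nonconstant unless the function field is `ℂ`, and the equation of
the curve makes the function field finite over `ℂ(x_j / x_i)`. -/
instance isCurveField : IsCurveField ℂ Q.functionField := by
  obtain ⟨i, hi⟩ := Q.exists_toFrac_X_ne_zero
  have hc := isHomogeneous_X ℂ i
  by_cases hconst : ∀ j, Q.coord hc j ∈ Set.range (algebraMap ℂ Q.functionField)
  · refine ⟨fun x hx => absurd ?_ hx⟩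
    have htop : (⊥ : IntermediateField ℂ Q.functionField) = ⊤ :=
      Q.eq_top_of_coord_mem hc hi fun j => mem_bot.2 (hconst j)
    exact mem_bot.1 (htop ▸ mem_top)
  push Not at hconst
  obtain ⟨j, hj⟩ := hconst
  have h1 : Q.coord hc i = 1 := by
    have := Q.aeval_coord_self hc hi
    rwa [aeval_X] at this
  have hij : i ≠ j := by
    rintro rfl
    exact hj ⟨1, by rw [h1, map_one]⟩
  obtain ⟨m, hmi, hmj⟩ : ∃ m : Fin 3, m ≠ i ∧ m ≠ j := by
    have : ∀ i j : Fin 3, ∃ m : Fin 3, m ≠ i ∧ m ≠ j := by decide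
    exact this i j
  have hall : ∀ l : Fin 3, l = i ∨ l = j ∨ l = m := by
    have : ∀ i j m : Fin 3, i ≠ j → m ≠ i → m ≠ j → ∀ l : Fin 3, l = i ∨ l = j ∨ l = m := by decide
    exact this i j m hij hmi hmj
  have htop : adjoin ℂ {Q.coord hc j, Q.coord hc m} = ⊤ := by
    refine Q.eq_top_of_coord_mem hc hi fun l => ?_
    rcases hall l with rfl | rfl | rfl
    · rw [h1]
      exact one_mem _
    · exact subset_adjoin _ _ (by simp)
    · exact subset_adjoin _ _ (by simp)
  have hjt := transcendental_of_notMem_range hj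
  have hgen : Transcendental ℂ (AdjoinSimple.gen ℂ (Q.coord hc j)) := by
    intro h
    apply hjt
    have := h.algebraMap (A := Q.functionField)
    rwa [AdjoinSimple.algebraMap_gen] at this
  obtain ⟨p, hp0, hpd, hpr⟩ := exists_root_of_isHomogeneous (K := Q.functionField)
    Q.homogeneous Q.irreducible.ne_zero (X_ne_zero i) hgen (y := Q.coord hc m)
    (α := Pi.single i 1) (β := Pi.single j 1) (γ := Pi.single m 1)
    (by
      rw [← (Q.aeval_coord_eq_zero_iff hc hi Q.homogeneous).2 dvd_rfl]
      congr 2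
      funext l
      rw [AdjoinSimple.algebraMap_gen]
      rcases hall l with rfl | rfl | rfl
      · simp [h1, hij, hmi.symm]
      · simp [hij.symm, hmj.symm]
      · simp [hmi, hmj])
    (by
      intro p hp
      rw [eval_X] at hp
      refine ⟨p j / p i, p m / p i, funext fun l => ?_⟩
      rw [eval_X]
      rcases hall l with rfl | rfl | rfl
      · simp [hij, hmi.symm]
      · simp [hij.symm, hmj.symm]
        field_simp
      · simp [hmi, hmj]
        field_simp)
  exact isCurveField_of_finiteDimensional (Set.toFinite _) htop
    (finrank_le_of_root htop hp0 hpd hpr).1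

end IrreduciblePlaneCurve

/-! ### Intersection multiplicity at a smooth point -/

theorem length_quotient_sup {R : Type*} [CommRing R] (I J : Ideal R) :
    Module.length R (R ⧸ (I ⊔ J)) =
      Module.length (R ⧸ I) ((R ⧸ I) ⧸ J.map (Ideal.Quotient.mk I)) := by
  rw [← Module.length_eq_of_surjective (R := R ⧸ I) (S := R)
    (M := (R ⧸ I) ⧸ J.map (Ideal.Quotient.mk I))
    Ideal.Quotient.mk_surjective]
  exact (DoubleQuot.quotQuotEquivQuotSupₐ R I J).toLinearEquiv.length_eq.symm

theorem ring_ord_unit_mul_pow {A : Type*} [CommRing A] [IsDomain A] [IsDiscreteValuationRing A]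
    {t : A} (ht : Irreducible t) (u : Aˣ) (n : ℕ) : Ring.ord A (u * t ^ n) = n := by
  have hu : Ring.ord A (u : A) = 0 := by
    rw [Ring.ord, Module.length_eq_zero_iff, Ideal.Quotient.subsingleton_iff,
      Ideal.span_singleton_eq_top]
    exact u.isUnit
  have ht1 : Ring.ord A t = 1 := by
    rw [Ring.ord, ← ht.maximalIdeal_eq, Module.length_eq_one_iff, isSimpleModule_iff_isCoatom,
      ← Ideal.isMaximal_def]
    infer_instance
  rw [Ring.ord_mul _ (mem_nonZeroDivisors_of_ne_zero (pow_ne_zero _ ht.ne_zero)), hu, zero_add,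
    Ring.ord_pow (mem_nonZeroDivisors_of_ne_zero ht.ne_zero), ht1, nsmul_one]

/-- Suppose that the local ring of `S / Q` at `P` has maximal ideal generated by `l`, so that it is
a discrete valuation ring. If the length of `S / (F, Q)` at `P` is `N`, then `F` is a unit times
`l ^ N` in this local ring. -/
theorem exists_mul_sub_mul_pow_mem {S : Type*} [CommRing S] [IsNoetherianRing S] (P : Ideal S)
    [P.IsPrime] {F Q l : S} [(Ideal.span {Q}).IsPrime] (hQP : Q ∈ P) (hFP : F ∈ P) (hlP : l ∈ P)
    (hF : F ∉ Ideal.span {Q}) (hl : ∀ x ∈ P, ∃ a ∉ P, a * x ∈ Ideal.span {Q, l}) {N : ℕ}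
    (hlen : lengthAt P (Ideal.span {F, Q}) = N) :
    ∃ a b, a ∉ P ∧ b ∉ P ∧ a * F - b * l ^ N ∈ Ideal.span {Q} := by
  let R := Localization.AtPrime P
  let f := algebraMap S R
  let J : Ideal R := (Ideal.span {Q}).map f
  have hdisj : Disjoint (P.primeCompl : Set S) (Ideal.span {Q} : Ideal S) := by
    rw [Set.disjoint_left]
    intro x hx hx'
    exact hx ((Ideal.span_singleton_le_iff_mem P).2 hQP hx')
  have hJ : J.IsPrime :=
    IsLocalization.isPrime_of_isPrime_disjoint P.primeCompl R _ inferInstance hdisj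
  have hcomap : J.comap f = Ideal.span {Q} :=
    IsLocalization.under_map_of_isPrime_disjoint P.primeCompl R inferInstance hdisj
  let A := R ⧸ J
  have : Nontrivial A := Ideal.Quotient.nontrivial_iff.2 hJ.ne_top
  have hloc : IsLocalRing A :=
    IsLocalRing.of_surjective' (Ideal.Quotient.mk J) Ideal.Quotient.mk_surjective
  have hnoeR : IsNoetherianRing R := IsLocalization.isNoetherianRing P.primeCompl R inferInstance
  let g : S →+* A := (Ideal.Quotient.mk J).comp f
  have hg : ∀ x, g x = 0 ↔ x ∈ Ideal.span {Q} := by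
    intro x
    rw [← hcomap, Ideal.mem_comap, ← Ideal.Quotient.eq_zero_iff_mem]
    rfl
  have hgu : ∀ x ∉ P, IsUnit (g x) := fun x hx =>
    (IsLocalization.map_units R (⟨x, hx⟩ : P.primeCompl)).map (Ideal.Quotient.mk J)
  have hgs : ∀ y : A, ∃ x : S, ∃ s ∉ P, y * g s = g x := by
    intro y
    obtain ⟨y, rfl⟩ := Ideal.Quotient.mk_surjective y
    obtain ⟨⟨x, s⟩, hxs⟩ := IsLocalization.surj P.primeCompl y
    exact ⟨x, s, s.2, congrArg (Ideal.Quotient.mk J) hxs⟩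
  have hgm : ∀ x ∈ P, g x ∈ IsLocalRing.maximalIdeal A := by
    intro x hx
    rw [IsLocalRing.mem_maximalIdeal, mem_nonunits_iff]
    intro hu
    have hloc' : IsLocalHom (Ideal.Quotient.mk J) :=
      IsLocalHom.of_surjective _ Ideal.Quotient.mk_surjective
    exact (IsLocalization.AtPrime.to_map_mem_maximal_iff R P x).2 hx
      (isUnit_of_map_unit (Ideal.Quotient.mk J) _ hu)
  have hmax : IsLocalRing.maximalIdeal A = Ideal.span {g l} := by
    apply le_antisymm
    · intro y hy
      obtain ⟨x, s, hs, hxs⟩ := hgs y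
      have hxP : x ∈ P := by
        by_contra hx
        have := hgu x hx
        rw [← hxs] at this
        exact hy (isUnit_of_mul_isUnit_left this)
      obtain ⟨a, ha, hax⟩ := hl x hxP
      have h1 : g (a * x) ∈ Ideal.span {g l} := by
        obtain ⟨b, c, hbc⟩ := Ideal.mem_span_pair.1 hax
        rw [← hbc, map_add, map_mul, map_mul, (hg Q).2 (Ideal.mem_span_singleton_self Q),
          mul_zero, zero_add]
        exact Ideal.mul_mem_left _ _ (Ideal.mem_span_singleton_self _)
      rw [map_mul, ← hxs, ← mul_assoc, mul_comm, ← mul_assoc] at h1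
      exact (Ideal.unit_mul_mem_iff_mem _ ((hgu s hs).mul (hgu a ha))).1 h1
    · rw [Ideal.span_singleton_le_iff_mem]
      exact hgm l hlP
  have hF0 : g F ≠ 0 := mt (hg F).1 hF
  have hfield : ¬ IsField A := by
    intro h
    apply hF0
    have := hgm F hFP
    rwa [IsLocalRing.isField_iff_maximalIdeal_eq.1 h, Ideal.mem_bot] at this
  have hdvr : IsDiscreteValuationRing A := by
    have := (IsDiscreteValuationRing.TFAE A hfield).out 4 0
    exact this.1 ⟨g l, hmax⟩
  have hirr : Irreducible (g l) :=
    (IsDiscreteValuationRing.irreducible_iff_uniformizer _).2 hmax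
  obtain ⟨n, u, hu⟩ := IsDiscreteValuationRing.eq_unit_mul_pow_irreducible hF0 hirr
  have hn : n = N := by
    have h1 : (Ideal.span {F, Q}).map f = J ⊔ Ideal.span {f F} := by
      rw [Ideal.span_insert, Ideal.map_sup, sup_comm, Ideal.map_span f {F}, Set.image_singleton]
    have h2 : lengthAt P (Ideal.span {F, Q}) = Ring.ord A (g F) := by
      change Module.length R (R ⧸ (Ideal.span {F, Q}).map f) = _
      rw [h1, length_quotient_sup, Ideal.map_span, Set.image_singleton]
      rfl
    rw [hlen, hu, ring_ord_unit_mul_pow hirr] at h2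
    exact_mod_cast h2.symm
  subst hn
  obtain ⟨b, a, ha, hab⟩ := hgs u
  refine ⟨a, b, ha, ?_, ?_⟩
  · intro hb
    have h1 := hgm b hb
    rw [← hab] at h1
    exact h1 (u.isUnit.mul (hgu a ha))
  · rw [← hg, map_sub, map_mul, map_mul, map_pow, hu, ← hab]
    ring

/-! ### The point of the plane below a place -/

theorem aeval_C_mul_X {σ R V : Type*} [Fintype σ] [CommRing R] [CommRing V] [Algebra R V]
    {F : MvPolynomial σ R} {n : ℕ} (hF : F.IsHomogeneous n) (y : σ → V) :
    aeval (fun i => Polynomial.C (y i) * (Polynomial.X : Polynomial V)) F =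
      Polynomial.C (aeval y F) * Polynomial.X ^ n := by
  have h := aeval_mul_of_isHomogeneous hF (Polynomial.X : Polynomial V) fun i => Polynomial.C (y i)
  simp only [mul_comm (Polynomial.X : Polynomial V)] at h
  rw [h, mul_comm, ← Polynomial.algebraMap_eq, ← aeval_algebraMap_apply]
  rfl

theorem mem_pointIdeal_iff {p : Fin 3 → ℂ} {F : PlanePoly} : F ∈ pointIdeal p ↔
    aeval (fun i => Polynomial.C (p i) * (Polynomial.X : Polynomial ℂ)) F = 0 := Iff.rfl

theorem aeval_pointIdeal {p : Fin 3 → ℂ} {F : PlanePoly} {n : ℕ} (hF : F.IsHomogeneous n) :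
    aeval (fun i => Polynomial.C (p i) * (Polynomial.X : Polynomial ℂ)) F =
      Polynomial.X ^ n * Polynomial.C (eval p F) := by
  rw [aeval_C_mul_X hF, mul_comm, aeval_eq_eval]

theorem mem_pointIdeal_of_isHomogeneous {p : Fin 3 → ℂ} {F : PlanePoly} {n : ℕ}
    (hF : F.IsHomogeneous n) : F ∈ pointIdeal p ↔ eval p F = 0 := by
  rw [mem_pointIdeal_iff, aeval_pointIdeal hF]
  simp

theorem eval_eq_zero_of_mem_pointIdeal {p : Fin 3 → ℂ} {F : PlanePoly} (hF : F ∈ pointIdeal p) :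
    eval p F = 0 := by
  have h := congrArg (Polynomial.aeval (1 : ℂ)) (mem_pointIdeal_iff.1 hF)
  rw [map_zero, ← AlgHom.comp_apply, comp_aeval] at h
  rw [← h, ← aeval_eq_eval]
  congr 2
  funext i
  simp

/-- The ideal of a point with `p i = 1` is generated by the linear forms `X j - p j X i`. -/
theorem pointIdeal_eq_span {p : Fin 3 → ℂ} {i : Fin 3} (hi : p i = 1) :
    pointIdeal p = Ideal.span (Set.range fun j => (X j - C (p j) * X i : PlanePoly)) := by
  apply le_antisymm
  · intro F hF
    set I := Ideal.span (Set.range fun j => (X j - C (p j) * X i : PlanePoly))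
    have h1 : (Ideal.Quotient.mkₐ ℂ I) = (Ideal.Quotient.mkₐ ℂ I).comp
        ((Polynomial.aeval (X i : PlanePoly)).comp
          (aeval fun j => Polynomial.C (p j) * (Polynomial.X : Polynomial ℂ))) := by
      refine MvPolynomial.algHom_ext fun j => ?_
      simp only [AlgHom.comp_apply, aeval_X, map_mul, Polynomial.aeval_C, Polynomial.aeval_X]
      rw [← sub_eq_zero, algebraMap_eq, ← map_mul, ← map_sub]
      exact Ideal.Quotient.eq_zero_iff_mem.2 (Ideal.subset_span ⟨j, rfl⟩)
    have h2 := congrArg (fun φ => φ F) h1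
    simp only [AlgHom.comp_apply] at h2
    rw [mem_pointIdeal_iff.1 hF, map_zero, map_zero] at h2
    exact Ideal.Quotient.eq_zero_iff_mem.1 h2
  · rw [Ideal.span_le]
    rintro _ ⟨j, rfl⟩
    rw [SetLike.mem_coe, mem_pointIdeal_iff]
    simp [hi]

/-- At a smooth point of the curve `Q = 0`, one linear form generates the maximal ideal of the
local ring. -/
theorem exists_generator_of_smooth {p : Fin 3 → ℂ} {i : Fin 3} (hi : p i = 1) {Q : PlanePoly}
    (hQ : Q ∈ pointIdeal p) (hsm : ¬ IsSingularPoint Q p) :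
    ∃ m, ∀ x ∈ pointIdeal p, ∃ a ∉ pointIdeal p,
      a * x ∈ Ideal.span {Q, X m - C (p m) * X i} := by
  set l : Fin 3 → PlanePoly := fun j => X j - C (p j) * X i with hl
  have hli : l i = 0 := by simp [hl, hi]
  have hlp : ∀ j, eval p (l j) = 0 := by simp [hl, hi]
  have hspan := pointIdeal_eq_span hi
  have hQ' := hQ
  rw [hspan, Ideal.mem_span_range_iff_exists_fun] at hQ'
  obtain ⟨A, hA⟩ := hQ'
  have hd : ∀ m, eval p (pderiv m Q) = ∑ j, eval p (A j) * eval p (pderiv m (l j)) := by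
    intro m
    rw [← hA, map_sum, map_sum]
    refine Finset.sum_congr rfl fun j _ => ?_
    rw [pderiv_mul, map_add, map_mul, map_mul]
    change _ * eval p (l j) + _ = _
    rw [hlp, mul_zero, zero_add]
  obtain ⟨j, hji, hj⟩ : ∃ j, j ≠ i ∧ eval p (A j) ≠ 0 := by
    by_contra! hcon
    refine hsm ⟨eval_eq_zero_of_mem_pointIdeal hQ, fun m => ?_⟩
    rw [hd]
    refine Finset.sum_eq_zero fun j _ => ?_
    by_cases hj : j = i
    · rw [hj, hli]
      simp
    · rw [hcon j hj, zero_mul]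
  obtain ⟨m, hmi, hmj⟩ : ∃ m : Fin 3, m ≠ i ∧ m ≠ j := by
    have : ∀ i j : Fin 3, ∃ m : Fin 3, m ≠ i ∧ m ≠ j := by decide
    exact this i j
  have hall : ∀ f : Fin 3 → PlanePoly, ∑ n, f n = f i + f j + f m := by
    have : ∀ i j m : Fin 3, j ≠ i → m ≠ i → m ≠ j → Finset.univ = {i, j, m} := by decide
    intro f
    rw [this i j m hji hmi hmj, Finset.sum_insert, Finset.sum_pair hmj.symm, add_assoc]
    simp [hji.symm, hmi.symm]
  refine ⟨m, fun x hx => ⟨A j, fun h => hj (eval_eq_zero_of_mem_pointIdeal h), ?_⟩⟩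
  rw [hspan, Ideal.mem_span_range_iff_exists_fun] at hx
  obtain ⟨B, rfl⟩ := hx
  change A j * ∑ n, B n * l n ∈ Ideal.span {Q, l m}
  replace hA : ∑ n, A n * l n = Q := hA
  rw [hall, hli] at hA
  rw [hall, hli]
  refine Ideal.mem_span_pair.2 ⟨B j, A j * B m - B j * A m, ?_⟩
  rw [← hA]
  ring

namespace Place

variable {k K : Type*} [Field k] [Field K] [Algebra k K] (v : Place k K)

instance : Algebra k v.ring :=
  ((algebraMap k K).codRestrict v.ring.toSubring v.algebraMap_mem).toAlgebra

instance : IsScalarTower k v.ring K := IsScalarTower.of_algebraMap_eq fun _ => rfl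

theorem ord_eq_zero_of_isUnit {f : v.ring} (hf : IsUnit f) : v.ord (f : K) = 0 := by
  obtain ⟨u, rfl⟩ := hf
  exact v.ord_eq_of_eq (u := u) v.irreducible_uniformizer (by simp)

/-- If the values of `y` at `v` are `p`, then the value of `A(y)` is `A(p)`. -/
theorem residue_aeval {σ : Type*} {y : σ → v.ring} {p : σ → k}
    (hp : ∀ j, IsLocalRing.residue v.ring (y j) =
      IsLocalRing.residue v.ring (algebraMap k v.ring (p j))) (A : MvPolynomial σ k) :
    IsLocalRing.residue v.ring (aeval y A) =
      IsLocalRing.residue v.ring (algebraMap k v.ring (eval p A)) := by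
  have h : (IsLocalRing.residue v.ring).comp (aeval y : MvPolynomial σ k →ₐ[k] v.ring).toRingHom =
      ((IsLocalRing.residue v.ring).comp (algebraMap k v.ring)).comp (eval p) := by
    apply MvPolynomial.ringHom_ext
    · intro a
      simp only [RingHom.comp_apply, AlgHom.toRingHom_eq_coe, RingHom.coe_coe, eval_C]
      rw [← algebraMap_eq, AlgHom.commutes]
    · intro j
      simp only [RingHom.comp_apply, AlgHom.toRingHom_eq_coe, RingHom.coe_coe, eval_X, aeval_X, hp]
  exact congrArg (fun f => f A) h

/-- The comparison of the contents of two polynomials over the valuation ring of `v`. -/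
theorem ord_eq_of_mul_eq {f g : v.ring} {A B : Polynomial v.ring} {a b : ℕ}
    (hA : A.map (IsLocalRing.residue v.ring) ≠ 0) (hB : B.map (IsLocalRing.residue v.ring) ≠ 0)
    (hf : f ≠ 0) (hg : g ≠ 0)
    (h : A * (Polynomial.C f * Polynomial.X ^ a) = B * (Polynomial.C g * Polynomial.X ^ b)) :
    v.ord (f : K) = v.ord (g : K) := by
  have key : ∀ {f g : v.ring} {A B : Polynomial v.ring} {a b : ℕ},
      A.map (IsLocalRing.residue v.ring) ≠ 0 → B.map (IsLocalRing.residue v.ring) ≠ 0 →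
      f ≠ 0 → g ≠ 0 →
      A * (Polynomial.C f * Polynomial.X ^ a) = B * (Polynomial.C g * Polynomial.X ^ b) →
      f ∣ g → v.ord (f : K) = v.ord (g : K) := by
    rintro f g A B a b hA hB hf hg h ⟨s, rfl⟩
    have hf' : (f : K) ≠ 0 := by simpa using hf
    have hs0 : s ≠ 0 := right_ne_zero_of_mul hg
    have hs' : (s : K) ≠ 0 := by simpa using hs0
    have h1 : A * Polynomial.X ^ a = B * (Polynomial.C s * Polynomial.X ^ b) := by
      apply mul_left_cancel₀ (Polynomial.C_ne_zero.2 hf)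
      rw [Polynomial.C_mul] at h
      linear_combination h
    have h2 := congrArg (Polynomial.map (IsLocalRing.residue v.ring)) h1
    simp only [Polynomial.map_mul, Polynomial.map_pow, Polynomial.map_X, Polynomial.map_C] at h2
    have hs : IsUnit s := by
      rw [← IsLocalRing.residue_ne_zero_iff_isUnit]
      intro h0
      rw [h0, Polynomial.C_0, zero_mul, mul_zero] at h2
      exact mul_ne_zero hA (pow_ne_zero _ Polynomial.X_ne_zero) h2
    rw [MulMemClass.coe_mul, v.ord_mul hf' hs', v.ord_eq_zero_of_isUnit hs, add_zero]
  rcases ValuationRing.dvd_total f g with hfg | hgf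
  · exact key hA hB hf hg h hfg
  · exact (key hB hA hg hf h.symm hgf).symm

/-- Let `p` be the point below the place `v` on the curve `Q = 0`. If `a F = b l ^ N` modulo `Q`
with `a` and `b` not vanishing at `p`, then the order of `F` at `v` is `N` times the order of `l`. -/
theorem ord_aeval_eq {K : Type*} [Field K] [Algebra ℂ K] (v : Place ℂ K) {y : Fin 3 → v.ring}
    {p : Fin 3 → ℂ} (hp : ∀ j, IsLocalRing.residue v.ring (y j) =
      IsLocalRing.residue v.ring (algebraMap ℂ v.ring (p j)))
    {Q F l a b : PlanePoly} {d n N : ℕ} (hQ : Q.IsHomogeneous d) (hyQ : aeval y Q = 0)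
    (hF : F.IsHomogeneous n) (hl : l.IsHomogeneous 1) (ha : a ∉ pointIdeal p)
    (hb : b ∉ pointIdeal p) (hab : Q ∣ a * F - b * l ^ N) (hyF : aeval y F ≠ 0) :
    v.ord ((aeval y F : v.ring) : K) = N * v.ord ((aeval y l : v.ring) : K) := by
  let ρ := IsLocalRing.residue v.ring
  have hρinj : Function.Injective (ρ.comp (algebraMap ℂ v.ring)) := RingHom.injective _
  -- Pass to polynomials over the valuation ring by `x_j ↦ y_j T`.
  let φ : PlanePoly →ₐ[ℂ] Polynomial v.ring := aeval fun j => Polynomial.C (y j) * Polynomial.X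
  have hφ : ∀ {A : PlanePoly} {m : ℕ}, A.IsHomogeneous m →
      φ A = Polynomial.C (aeval y A) * Polynomial.X ^ m := fun hA => aeval_C_mul_X hA y
  have hφρ : ∀ A : PlanePoly, A ∉ pointIdeal p → (φ A).map ρ ≠ 0 := by
    intro A hA h
    apply hA
    rw [mem_pointIdeal_iff]
    apply Polynomial.map_injective _ hρinj
    rw [Polynomial.map_zero, ← h]
    have h1 : (Polynomial.mapRingHom (ρ.comp (algebraMap ℂ v.ring))).comp
        (aeval fun i => Polynomial.C (p i) * (Polynomial.X : Polynomial ℂ) :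
          PlanePoly →ₐ[ℂ] Polynomial ℂ).toRingHom =
        (Polynomial.mapRingHom ρ).comp φ.toRingHom := by
      apply MvPolynomial.ringHom_ext
      · intro a
        simp only [RingHom.comp_apply, AlgHom.toRingHom_eq_coe, RingHom.coe_coe]
        rw [← algebraMap_eq, AlgHom.commutes, AlgHom.commutes]
        simp [Polynomial.algebraMap_apply]
      · intro j
        simp [φ]
        exact (hp j).symm
    exact congrArg (fun f => f A) h1
  have hφQ : φ Q = 0 := by
    rw [hφ hQ, hyQ, Polynomial.C_0, zero_mul]
  have heq : φ a * φ F = φ b * φ l ^ N := by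
    obtain ⟨e, he⟩ := hab
    have := congrArg φ he
    rw [map_mul, hφQ, zero_mul, map_sub, sub_eq_zero, map_mul, map_mul, map_pow] at this
    exact this
  rw [hφ hF, hφ hl, pow_one, mul_pow, ← Polynomial.C_pow] at heq
  have hl0 : aeval y l ^ N ≠ 0 := by
    intro h0
    rw [h0, Polynomial.C_0, zero_mul, mul_zero] at heq
    refine mul_ne_zero (fun h => hφρ a ha ?_) (mul_ne_zero (Polynomial.C_ne_zero.2 hyF)
      (pow_ne_zero _ Polynomial.X_ne_zero)) heq
    rw [h, Polynomial.map_zero]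
  rw [v.ord_eq_of_mul_eq (hφρ a ha) (hφρ b hb) hyF hl0 heq, SubmonoidClass.coe_pow, v.ord_pow]

/-- Regular functions with rational values at `v`. -/
theorem exists_residue_eq [IsAlgClosed k] [IsCurveField k K] {σ : Type*} (y : σ → v.ring) :
    ∃ p : σ → k, ∀ j, IsLocalRing.residue v.ring (y j) =
      IsLocalRing.residue v.ring (algebraMap k v.ring (p j)) := by
  refine ⟨_, fun j => Classical.choose_spec (?_ : ∃ a : k, IsLocalRing.residue v.ring (y j) =
      IsLocalRing.residue v.ring (algebraMap k v.ring a))⟩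
  obtain ⟨a, ha⟩ := v.exists_sub_algebraMap (y j).2
  refine ⟨a, ?_⟩
  rw [← sub_eq_zero, ← map_sub]
  by_cases h0 : y j - algebraMap k v.ring a = 0
  · rw [h0, map_zero]
  · rw [IsLocalRing.residue_eq_zero_iff, v.mem_maximalIdeal_iff h0]
    rcases ha with ha | ha
    · exact absurd (Subtype.ext (sub_eq_zero.2 ha)) h0
    · exact ha

end Place

namespace IrreduciblePlaneCurve

variable {d : ℕ} (Q : IrreduciblePlaneCurve d)

/-- Dividing by a coordinate of minimal order makes all coordinates regular at `v`. -/
theorem exists_coord_eq_mul {c : PlanePoly} (hc : c.IsHomogeneous 1) (hc0 : Q.toFrac c ≠ 0)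
    (v : Place ℂ Q.functionField) : ∃ (z : Q.functionField) (y : Fin 3 → v.ring) (i : Fin 3),
      z ≠ 0 ∧ y i = 1 ∧ ∀ j, Q.coord hc j = z * (y j : Q.functionField) := by
  classical
  obtain ⟨i, hi0, himin⟩ : ∃ i, Q.coord hc i ≠ 0 ∧ ∀ j, Q.coord hc j ≠ 0 →
      v.ord (Q.coord hc i) ≤ v.ord (Q.coord hc j) := by
    have hne : (Finset.univ.filter fun j => Q.coord hc j ≠ 0).Nonempty := by
      by_contra hemp
      rw [Finset.not_nonempty_iff_eq_empty, Finset.filter_eq_empty_iff] at hemp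
      have h0 : Q.coord hc = 0 := funext fun j => not_not.1 (hemp (Finset.mem_univ j))
      have h1 := Q.aeval_coord_self hc hc0
      have h2 := aeval_mul_of_isHomogeneous hc (0 : Q.functionField) (Q.coord hc)
      rw [pow_one, zero_mul] at h2
      have h3 : (fun j => (0 : Q.functionField) * Q.coord hc j) = Q.coord hc := by
        rw [h0]
        funext j
        simp
      rw [h3, h1] at h2
      exact one_ne_zero h2
    obtain ⟨i, hi, himin⟩ := Finset.exists_min_image _ (fun j => v.ord (Q.coord hc j)) hne
    refine ⟨i, (Finset.mem_filter.1 hi).2, fun j hj => himin j ?_⟩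
    exact Finset.mem_filter.2 ⟨Finset.mem_univ j, hj⟩
  set z := Q.coord hc i
  have hymem : ∀ j, Q.coord hc j / z ∈ v.ring := by
    intro j
    by_cases hj : Q.coord hc j = 0
    · rw [hj, zero_div]
      exact zero_mem _
    · rw [← v.ord_nonneg_iff, div_eq_mul_inv, v.ord_mul hj (inv_ne_zero hi0), v.ord_inv]
      have := himin j hj
      omega
  refine ⟨z, fun j => ⟨_, hymem j⟩, i, hi0, Subtype.ext (div_self hi0), fun j => ?_⟩
  exact (mul_div_cancel₀ _ hi0).symm

theorem aeval_coord_eq_mul {c : PlanePoly} (hc : c.IsHomogeneous 1) {v : Place ℂ Q.functionField}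
    {z : Q.functionField} {y : Fin 3 → v.ring}
    (hzy : ∀ j, Q.coord hc j = z * (y j : Q.functionField)) {A : PlanePoly} {m : ℕ}
    (hA : A.IsHomogeneous m) :
    aeval (Q.coord hc) A = z ^ m * ((aeval y A : v.ring) : Q.functionField) := by
  have h1 : ((aeval y A : v.ring) : Q.functionField) =
      aeval (fun j => (y j : Q.functionField)) A := by
    change (IsScalarTower.toAlgHom ℂ v.ring Q.functionField) (aeval y A) = _
    rw [← AlgHom.comp_apply, comp_aeval]
    rfl
  rw [h1, ← aeval_mul_of_isHomogeneous hA]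
  congr 2
  exact funext hzy

/-- If `F = 0` meets the curve `Q` only in smooth points of `Q` and with even multiplicities, then
the rational function `F / c ^ n` has even order at every place. The place lies over a point of
the curve; if `F` vanishes there, this is a smooth point, its local ring is a discrete valuation
ring, and the order of `F` is the intersection multiplicity. -/
theorem even_ord_aeval_coord {c F : PlanePoly} (hc : c.IsHomogeneous 1) (hc0 : Q.toFrac c ≠ 0)
    {n : ℕ} (hn : Even n) (hF : F.IsHomogeneous n) (hQF : ¬ Q.form ∣ F)
    (hsm : ∀ p : Fin 3 → ℂ, p ≠ 0 → eval p F = 0 → eval p Q.form = 0 → ¬ IsSingularPoint Q.form p)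
    (heven : ∀ p : Fin 3 → ℂ, p ≠ 0 → eval p F = 0 → eval p Q.form = 0 →
      ∃ m : ℕ, intersectionMultiplicity F Q.form p = ((2 * m : ℕ) : ℕ∞))
    (v : Place ℂ Q.functionField) : Even (v.ord (aeval (Q.coord hc) F)) := by
  obtain ⟨z, y, i, hi0, hyi, hzy⟩ := Q.exists_coord_eq_mul hc hc0 v
  have hscale : ∀ {A : PlanePoly} {m : ℕ}, A.IsHomogeneous m →
      aeval (Q.coord hc) A = z ^ m * ((aeval y A : v.ring) : Q.functionField) :=
    Q.aeval_coord_eq_mul hc hzy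
  obtain ⟨p, hp⟩ := v.exists_residue_eq y
  let ρ := IsLocalRing.residue v.ring
  have hρinj : Function.Injective (ρ.comp (algebraMap ℂ v.ring)) := RingHom.injective _
  have hpi : p i = 1 := by
    apply hρinj
    rw [RingHom.comp_apply, ← hp, hyi, map_one, map_one]
  have hp0 : p ≠ 0 := by
    intro h
    rw [h] at hpi
    exact zero_ne_one hpi
  have hρeval : ∀ A : PlanePoly, ρ (aeval y A) = ρ (algebraMap ℂ v.ring (eval p A)) :=
    v.residue_aeval hp
  have hyQ : aeval y Q.form = 0 := by
    have h1 := (Q.aeval_coord_eq_zero_iff hc hc0 Q.homogeneous).2 dvd_rfl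
    rw [hscale Q.homogeneous] at h1
    have h2 := (mul_eq_zero.1 h1).resolve_left (pow_ne_zero _ hi0)
    exact Subtype.ext h2
  have hpQ : eval p Q.form = 0 := by
    apply hρinj
    rw [RingHom.comp_apply, ← hρeval, hyQ, map_zero, map_zero]
  have hyF : aeval y F ≠ 0 := by
    intro h
    apply hQF
    rw [← Q.aeval_coord_eq_zero_iff hc hc0 hF, hscale hF, h]
    simp
  have hyF' : ((aeval y F : v.ring) : Q.functionField) ≠ 0 := by
    simpa using hyF
  rw [hscale hF, v.ord_mul (pow_ne_zero _ hi0) hyF', v.ord_pow]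
  refine Even.add (Even.mul_right (by exact_mod_cast hn) _) ?_
  by_cases hpF : eval p F = 0
  swap
  · rw [v.ord_eq_zero_of_isUnit]
    · exact Even.zero
    · rw [← IsLocalRing.residue_ne_zero_iff_isUnit]
      change ρ _ ≠ 0
      rw [hρeval]
      intro h
      exact hpF (hρinj (by rw [RingHom.comp_apply, h, map_zero]))
  obtain ⟨m, hm⟩ := heven p hp0 hpF hpQ
  have hQP := (mem_pointIdeal_of_isHomogeneous Q.homogeneous).2 hpQ
  have hFP := (mem_pointIdeal_of_isHomogeneous hF).2 hpF
  obtain ⟨j, hj⟩ := exists_generator_of_smooth hpi hQP (hsm p hp0 hpF hpQ)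
  have hl1 : (X j - C (p j) * X i : PlanePoly).IsHomogeneous 1 :=
    (isHomogeneous_X _ _).sub (isHomogeneous_C_mul_X _ _)
  have hlP : (X j - C (p j) * X i : PlanePoly) ∈ pointIdeal p := by
    rw [mem_pointIdeal_of_isHomogeneous hl1]
    simp [hpi]
  obtain ⟨a, b, ha, hb, hab⟩ := exists_mul_sub_mul_pow_mem (pointIdeal p) hQP hFP hlP
    (mt Ideal.mem_span_singleton.1 hQF) hj hm
  rw [v.ord_aeval_eq hp Q.homogeneous hyQ hF hl1 ha hb (Ideal.mem_span_singleton.1 hab) hyF]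
  push_cast
  exact Even.mul_right (by simp) _

end IrreduciblePlaneCurve

/-! ### Curves on the double cover -/

/-- Evaluation at the generic point of a cone: the coefficient of `T ^ n` of `F(y T)` is the value
at `y` of the homogeneous component of degree `n`. -/
theorem coeff_aeval_C_mul_X {σ R V : Type*} [Fintype σ] [CommRing R] [CommRing V] [Algebra R V]
    (F : MvPolynomial σ R) (y : σ → V) (n : ℕ) :
    (aeval (fun i => Polynomial.C (y i) * (Polynomial.X : Polynomial V)) F).coeff n =
      aeval y (homogeneousComponent n F) := by
  have h1 : aeval (fun i => Polynomial.C (y i) * (Polynomial.X : Polynomial V)) F =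
      ∑ m ∈ Finset.range (F.totalDegree + 1),
        Polynomial.C (aeval y (homogeneousComponent m F)) * Polynomial.X ^ m := by
    conv_lhs => rw [← sum_homogeneousComponent F, map_sum]
    exact Finset.sum_congr rfl fun m _ => aeval_C_mul_X (homogeneousComponent_isHomogeneous m F) y
  rw [h1, Polynomial.finsetSum_coeff]
  simp only [Polynomial.coeff_C_mul_X_pow]
  rw [Finset.sum_ite_eq]
  split_ifs with h
  · rfl
  · rw [homogeneousComponent_eq_zero, map_zero]
    rw [Finset.mem_range] at h
    omega

theorem aeval_C_mul_X_eq_zero_iff {σ R V : Type*} [Fintype σ] [CommRing R] [CommRing V]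
    [Algebra R V] (F : MvPolynomial σ R) (y : σ → V) :
    aeval (fun i => Polynomial.C (y i) * (Polynomial.X : Polynomial V)) F = 0 ↔
      ∀ n, aeval y (homogeneousComponent n F) = 0 := by
  rw [Polynomial.ext_iff]
  simp only [coeff_aeval_C_mul_X, Polynomial.coeff_zero]

section Cone

variable {E : Type*} [Field E] [Algebra ℂ E] (x : Fin 3 → E) (g : E)

/-- The restriction of polynomials to the line in four-space through the point with coordinates
`x` and `g` (in a field `E`). -/
def coneMap : SpacePoly →ₐ[ℂ] Polynomial E :=
  aeval fun i => Polynomial.C ((Fin.snoc x g : Fin 4 → E) i) * Polynomial.X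

/-- The homogeneous prime ideal of the subvariety of `ℙ³` with generic point `(x : g)`. -/
def coneIdeal : Ideal SpacePoly := RingHom.ker (coneMap x g)

instance : (coneIdeal x g).IsPrime := RingHom.ker_isPrime _

theorem mem_coneIdeal {H : SpacePoly} : H ∈ coneIdeal x g ↔ coneMap x g H = 0 := Iff.rfl

theorem homogeneousComponent_mem_coneIdeal {H : SpacePoly} (hH : H ∈ coneIdeal x g) (n : ℕ) :
    homogeneousComponent n H ∈ coneIdeal x g := by
  rw [mem_coneIdeal, coneMap, aeval_C_mul_X (homogeneousComponent_isHomogeneous n H)]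
  rw [mem_coneIdeal, coneMap, aeval_C_mul_X_eq_zero_iff] at hH
  rw [hH, Polynomial.C_0, zero_mul]

theorem coneMap_rename (a : PlanePoly) : coneMap x g (rename Fin.castSucc a) =
    aeval (fun j => Polynomial.C (x j) * Polynomial.X) a := by
  rw [coneMap, aeval_rename]
  congr 2
  funext j
  simp

theorem coneMap_last : coneMap x g (X (Fin.last 3)) = Polynomial.C g * Polynomial.X := by
  rw [coneMap, aeval_X, Fin.snoc_last]

variable {x} {q : PlanePoly} {d : ℕ} (hq : q.IsHomogeneous d)
  (hx : ∀ (n : ℕ) (a : PlanePoly), a.IsHomogeneous n → (aeval x a = 0 ↔ q ∣ a))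

include hq hx in
theorem aeval_cone_eq_zero_iff (a : PlanePoly) :
    aeval (fun j => Polynomial.C (x j) * (Polynomial.X : Polynomial E)) a = 0 ↔ q ∣ a := by
  constructor
  · intro h
    rw [aeval_C_mul_X_eq_zero_iff] at h
    rw [← sum_homogeneousComponent a]
    exact Finset.dvd_sum fun n _ =>
      (hx n _ (homogeneousComponent_isHomogeneous n a)).1 (h n)
  · rintro ⟨b, rfl⟩
    rw [map_mul, aeval_C_mul_X hq, (hx d q hq).2 dvd_rfl, Polynomial.C_0, zero_mul, zero_mul]

include hq hx in
theorem rename_mem_coneIdeal_iff (a : PlanePoly) :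
    rename Fin.castSucc a ∈ coneIdeal x g ↔ q ∣ a := by
  rw [mem_coneIdeal, coneMap_rename, aeval_cone_eq_zero_iff hq hx]

variable {C : PlanePoly} (hC : C.IsHomogeneous 2)

include hC in
theorem coneMap_rename_conic {g : E} (hg : g ^ 2 = aeval x C) :
    coneMap x g (rename Fin.castSucc C) = (Polynomial.C g * Polynomial.X) ^ 2 := by
  rw [coneMap_rename, aeval_C_mul_X hC, ← hg, mul_pow, Polynomial.C_pow]

include hC in
theorem coverEquation_mem_coneIdeal {g : E} (hg : g ^ 2 = aeval x C) :
    coverEquation C ∈ coneIdeal x g := by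
  rw [mem_coneIdeal, coverEquation, map_sub, map_pow, coneMap_last, coneMap_rename_conic hC hg,
    sub_self]

/-- Polynomials on the double cover are of the form `a + b w`. -/
theorem exists_coverEquation_dvd_sub (C : PlanePoly) (H : SpacePoly) : ∃ a b : PlanePoly,
    coverEquation C ∣
      H - (rename Fin.castSucc a + rename Fin.castSucc b * X (Fin.last 3)) := by
  induction H using MvPolynomial.induction_on with
  | C r => exact ⟨MvPolynomial.C r, 0, by simp⟩
  | add F G hF hG =>
    obtain ⟨a, b, h⟩ := hF
    obtain ⟨a', b', h'⟩ := hG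
    refine ⟨a + a', b + b', ?_⟩
    have := dvd_add h h'
    rw [map_add, map_add]
    convert this using 1
    ring
  | mul_X F i hF =>
    obtain ⟨a, b, h⟩ := hF
    induction i using Fin.lastCases with
    | last =>
      refine ⟨b * C, a, ?_⟩
      have h1 := dvd_add (h.mul_right (X (Fin.last 3)))
        (dvd_mul_left (coverEquation C) (rename Fin.castSucc b))
      rw [map_mul]
      convert h1 using 1
      rw [coverEquation]
      ring
    | cast j =>
      refine ⟨a * X j, b * X j, ?_⟩
      have h1 := h.mul_right (X (Fin.castSucc j))
      rw [map_mul, map_mul, rename_X]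
      convert h1 using 1
      ring

variable (q) in
/-- The ideal of the inverse image of the curve `q = 0` in the double cover. -/
def pullbackIdeal (C : PlanePoly) : Ideal SpacePoly :=
  Ideal.span {coverEquation C, rename Fin.castSucc q}

include hq hx hC in
theorem pullbackIdeal_le_coneIdeal {g : E} (hg : g ^ 2 = aeval x C) :
    pullbackIdeal q C ≤ coneIdeal x g := by
  rw [pullbackIdeal, Ideal.span_le]
  rintro _ (rfl | rfl)
  · exact coverEquation_mem_coneIdeal hC hg
  · exact (rename_mem_coneIdeal_iff g hq hx q).2 dvd_rfl

theorem mem_pullbackIdeal_of_dvd {H : SpacePoly} {a b : PlanePoly}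
    (h : coverEquation C ∣ H - (rename Fin.castSucc a + rename Fin.castSucc b * X (Fin.last 3)))
    (ha : q ∣ a) (hb : q ∣ b) : H ∈ pullbackIdeal q C := by
  obtain ⟨e, he⟩ := h
  obtain ⟨a, rfl⟩ := ha
  obtain ⟨b, rfl⟩ := hb
  refine Ideal.mem_span_pair.2
    ⟨e, rename Fin.castSucc a + rename Fin.castSucc b * X (Fin.last 3), ?_⟩
  rw [sub_eq_iff_eq_add] at he
  rw [he, map_mul, map_mul]
  ring

include hC in
theorem coneMap_eq_of_dvd {g : E} (hg : g ^ 2 = aeval x C) {H : SpacePoly} {a b : PlanePoly}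
    (h : coverEquation C ∣ H - (rename Fin.castSucc a + rename Fin.castSucc b * X (Fin.last 3))) :
    coneMap x g H = aeval (fun j => Polynomial.C (x j) * Polynomial.X) a +
      aeval (fun j => Polynomial.C (x j) * Polynomial.X) b * (Polynomial.C g * Polynomial.X) := by
  obtain ⟨e, he⟩ := h
  have h1 := congrArg (coneMap x g) he
  rw [map_mul, (mem_coneIdeal x g).1 (coverEquation_mem_coneIdeal hC hg), zero_mul, map_sub,
    sub_eq_zero, map_add, map_mul, coneMap_rename, coneMap_rename, coneMap_last] at h1
  exact h1

include hq hx hC in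
/-- If `g = √C` is linearly independent of `1` over the function field of the curve `q = 0`, the
inverse image of the curve in the double cover is irreducible. -/
theorem coneIdeal_eq_pullbackIdeal {g : E} (hg : g ^ 2 = aeval x C)
    (hlin : ∀ (n : ℕ) (a b : PlanePoly), a.IsHomogeneous (n + 1) → b.IsHomogeneous n →
      aeval x a + aeval x b * g = 0 → aeval x b = 0) :
    coneIdeal x g = pullbackIdeal q C := by
  refine le_antisymm (fun H hH => ?_) (pullbackIdeal_le_coneIdeal hq hx hC hg)
  obtain ⟨a, b, hab⟩ := exists_coverEquation_dvd_sub C H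
  rw [mem_coneIdeal, coneMap_eq_of_dvd hC hg hab] at hH
  have hb : aeval (fun j => Polynomial.C (x j) * (Polynomial.X : Polynomial E)) b = 0 := by
    rw [aeval_C_mul_X_eq_zero_iff]
    intro n
    have h1 := congrArg (fun p => Polynomial.coeff p (n + 1)) hH
    simp only [Polynomial.coeff_add, Polynomial.coeff_zero] at h1
    rw [← mul_assoc, Polynomial.coeff_mul_X, Polynomial.coeff_mul_C, coeff_aeval_C_mul_X,
      coeff_aeval_C_mul_X] at h1
    exact hlin n _ _ (homogeneousComponent_isHomogeneous _ _)
      (homogeneousComponent_isHomogeneous _ _) h1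
  rw [hb, zero_mul, add_zero] at hH
  exact mem_pullbackIdeal_of_dvd hab ((aeval_cone_eq_zero_iff hq hx a).1 hH)
    ((aeval_cone_eq_zero_iff hq hx b).1 hb)

include hq hx hC in
/-- The inverse image of the curve `q = 0` is the reduced union of the two curves `w = g` and
`w = -g`. -/
theorem coneIdeal_inf_coneIdeal_neg {g : E} (hg : g ^ 2 = aeval x C) (hg0 : g ≠ 0) :
    coneIdeal x g ⊓ coneIdeal x (-g) = pullbackIdeal q C := by
  have hg' : (-g) ^ 2 = aeval x C := by rw [neg_sq, hg]
  refine le_antisymm (fun H hH => ?_) (le_inf (pullbackIdeal_le_coneIdeal hq hx hC hg)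
    (pullbackIdeal_le_coneIdeal hq hx hC hg'))
  obtain ⟨a, b, hab⟩ := exists_coverEquation_dvd_sub C H
  obtain ⟨h1, h2⟩ := hH
  have h1 : coneMap x g H = 0 := h1
  have h2 : coneMap x (-g) H = 0 := h2
  rw [coneMap_eq_of_dvd hC hg hab] at h1
  rw [coneMap_eq_of_dvd hC hg' hab, Polynomial.C_neg] at h2
  have hgX : (Polynomial.C g * Polynomial.X : Polynomial E) ≠ 0 :=
    mul_ne_zero (Polynomial.C_ne_zero.2 hg0) Polynomial.X_ne_zero
  have : CharZero E := charZero_of_injective_algebraMap (algebraMap ℂ E).injective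
  have h3 : (2 : Polynomial E) *
      aeval (fun j => Polynomial.C (x j) * (Polynomial.X : Polynomial E)) a = 0 := by
    linear_combination h1 + h2
  have ha := (mul_eq_zero.1 h3).resolve_left two_ne_zero
  rw [ha, zero_add] at h1
  have hb := (mul_eq_zero.1 h1).resolve_right hgX
  exact mem_pullbackIdeal_of_dvd hab ((aeval_cone_eq_zero_iff hq hx a).1 ha)
    ((aeval_cone_eq_zero_iff hq hx b).1 hb)

include hq hx hC in
/-- Between `0` and the ideal of a curve on the double cover lies the ideal of the cylinder
over `q = 0`. -/
theorem two_le_height_coneIdeal {g : E} (hg : g ^ 2 = aeval x C) (hq0 : q ≠ 0) :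
    2 ≤ (coneIdeal x g).height := by
  let ψ : SpacePoly →ₐ[ℂ] Polynomial (Polynomial E) := aeval
    (Fin.snoc (fun j => Polynomial.C (Polynomial.C (x j) * Polynomial.X)) Polynomial.X :
      Fin 4 → Polynomial (Polynomial E))
  have hψl : ψ (X (Fin.last 3)) = Polynomial.X := by
    rw [aeval_X, Fin.snoc_last]
  have hψ : coneMap x g = ((Polynomial.aeval (R := Polynomial E)
      (Polynomial.C g * Polynomial.X)).restrictScalars ℂ).comp ψ := by
    refine MvPolynomial.algHom_ext fun i => ?_
    induction i using Fin.lastCases with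
    | last =>
      rw [coneMap_last, AlgHom.comp_apply, hψl, AlgHom.restrictScalars_apply, Polynomial.aeval_X]
    | cast j => simp [ψ, coneMap]
  have hψr : ∀ a : PlanePoly, ψ (rename Fin.castSucc a) = Polynomial.C
      (aeval (fun j => Polynomial.C (x j) * (Polynomial.X : Polynomial E)) a) := by
    intro a
    have h1 : ψ (rename Fin.castSucc a) =
        aeval (fun j => algebraMap (Polynomial E) (Polynomial (Polynomial E))
          (Polynomial.C (x j) * Polynomial.X)) a := by
      rw [aeval_rename]
      congr 2
      funext j
      simp [Polynomial.algebraMap_eq]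
    rw [h1]
    exact aeval_algebraMap_apply _ _ _
  have hp : (RingHom.ker ψ).IsPrime := RingHom.ker_isPrime _
  have h1 : (⊥ : Ideal SpacePoly) < RingHom.ker ψ := by
    rw [bot_lt_iff_ne_bot]
    intro h
    have h2 : rename Fin.castSucc q ∈ RingHom.ker ψ := by
      rw [RingHom.mem_ker, hψr, (aeval_cone_eq_zero_iff hq hx q).2 dvd_rfl, Polynomial.C_0]
    rw [h, Ideal.mem_bot] at h2
    exact hq0 (rename_injective _ (Fin.castSucc_injective 3) (by rw [h2, map_zero]))
  have h2 : RingHom.ker ψ < coneIdeal x g := by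
    refine lt_of_le_of_ne (fun H hH => ?_) fun h => ?_
    · rw [mem_coneIdeal, hψ, AlgHom.comp_apply, (RingHom.mem_ker).1 hH, map_zero]
    · have h3 := coverEquation_mem_coneIdeal hC hg
      rw [← h, RingHom.mem_ker, coverEquation, map_sub, map_pow, hψr, hψl] at h3
      have h4 := congrArg (fun p => Polynomial.coeff p 2) h3
      simp only [Polynomial.coeff_sub, Polynomial.coeff_X_pow, Polynomial.coeff_C,
        Polynomial.coeff_zero] at h4
      simp at h4
  have h3 := Ideal.height_add_one_le_of_lt_of_isPrime h1
  have h4 := Ideal.height_add_one_le_of_lt_of_isPrime h2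
  calc (2 : ℕ∞) = 0 + 1 + 1 := by norm_num
    _ ≤ (⊥ : Ideal SpacePoly).height + 1 + 1 := by gcongr; exact zero_le
    _ ≤ (RingHom.ker ψ).height + 1 := by gcongr
    _ ≤ _ := h4

end Cone

theorem lengthAt_eq_zero {R : Type*} [CommRing R] (P : Ideal R) [P.IsPrime] {I : Ideal R}
    (h : ¬ I ≤ P) : lengthAt P I = 0 := by
  rw [lengthAt, Module.length_eq_zero_iff, Ideal.Quotient.subsingleton_iff]
  obtain ⟨a, haI, haP⟩ := SetLike.not_le_iff_exists.1 h
  exact Ideal.eq_top_of_isUnit_mem _ (Ideal.mem_map_of_mem _ haI)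
    (IsLocalization.map_units (Localization.AtPrime P) (⟨a, haP⟩ : P.primeCompl))

theorem lengthAt_inf_eq_one {R : Type*} [CommRing R] (P P' : Ideal R) [P.IsPrime]
    (h : ¬ P' ≤ P) : lengthAt P (P ⊓ P') = 1 := by
  have hmap : (P ⊓ P').map (algebraMap R (Localization.AtPrime P)) =
      IsLocalRing.maximalIdeal (Localization.AtPrime P) := by
    rw [← Localization.AtPrime.map_eq_maximalIdeal]
    refine le_antisymm (Ideal.map_mono inf_le_left) ?_
    rw [Ideal.map_le_iff_le_comap]
    intro y hy
    obtain ⟨a, haP', haP⟩ := SetLike.not_le_iff_exists.1 h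
    rw [Ideal.mem_comap, ← Ideal.unit_mul_mem_iff_mem _
      (IsLocalization.map_units (Localization.AtPrime P) (⟨a, haP⟩ : P.primeCompl)), ← map_mul]
    exact Ideal.mem_map_of_mem _ ⟨P.mul_mem_left _ hy, P'.mul_mem_right _ haP'⟩
  rw [lengthAt, hmap, Module.length_eq_one_iff, isSimpleModule_iff_isCoatom, ← Ideal.isMaximal_def]
  infer_instance

/-! ### Splitting of the inverse image when the conic is a square in the function field -/

section Split

variable {E : Type*} [Field E] [Algebra ℂ E] {x : Fin 3 → E} {q : PlanePoly} {d : ℕ}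
  (hq : q.IsHomogeneous d)
  (hx : ∀ (n : ℕ) (a : PlanePoly), a.IsHomogeneous n → (aeval x a = 0 ↔ q ∣ a))
  {C : PlanePoly} (hC : C.IsHomogeneous 2)

theorem comap_coverInvolution_coneIdeal (x : Fin 3 → E) (g : E) :
    (coneIdeal x g).comap coverInvolution = coneIdeal x (-g) := by
  have h : (coneMap x g).comp coverInvolution = coneMap x (-g) := by
    refine MvPolynomial.algHom_ext fun i => ?_
    rw [AlgHom.comp_apply, coverInvolution, aeval_X]
    induction i using Fin.lastCases with
    | last => rw [if_pos rfl, map_neg, coneMap_last, coneMap_last, Polynomial.C_neg, neg_mul]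
    | cast j =>
      rw [if_neg (Fin.castSucc_lt_last j).ne, coneMap, coneMap, aeval_X, aeval_X,
        Fin.snoc_castSucc, Fin.snoc_castSucc]
  ext H
  rw [Ideal.mem_comap, mem_coneIdeal, mem_coneIdeal, ← h]
  rfl

theorem eval_snoc_rename (p : Fin 3 → ℂ) (w : ℂ) (a : PlanePoly) :
    eval (Fin.snoc p w : Fin 4 → ℂ) (rename Fin.castSucc a) = eval p a := by
  rw [eval_rename]
  congr 2
  funext j
  simp

include hC in
/-- Over every point of `q = 0` lies a point of the curve `w = g`. The norm `a ^ 2 - b ^ 2 C` of an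
element `a + b w` of the ideal of `w = g` is divisible by `q`, so the element vanishes at one of the
two points `w = ±√C` of the fibre; hence so does the whole ideal, which is not the union of two
proper additive subgroups. -/
theorem exists_eval_eq_zero_of_mem_coneIdeal (hq : q.IsHomogeneous d)
    (hx : ∀ (n : ℕ) (a : PlanePoly), a.IsHomogeneous n → (aeval x a = 0 ↔ q ∣ a))
    {g : E} (hg : g ^ 2 = aeval x C) {p : Fin 3 → ℂ} (hp : eval p q = 0) :
    ∃ w : ℂ, ∀ H ∈ coneIdeal x g, eval (Fin.snoc p w : Fin 4 → ℂ) H = 0 := by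
  obtain ⟨w, hw⟩ := IsAlgClosed.exists_pow_nat_eq (eval p C) (n := 2) two_pos
  by_contra! hno
  obtain ⟨H₁, hH₁, h₁⟩ := hno w
  obtain ⟨H₂, hH₂, h₂⟩ := hno (-w)
  obtain ⟨H, hH, h, h'⟩ : ∃ H ∈ coneIdeal x g, eval (Fin.snoc p w : Fin 4 → ℂ) H ≠ 0 ∧
      eval (Fin.snoc p (-w) : Fin 4 → ℂ) H ≠ 0 := by
    by_cases h₃ : eval (Fin.snoc p (-w) : Fin 4 → ℂ) H₁ = 0
    · by_cases h₄ : eval (Fin.snoc p w : Fin 4 → ℂ) H₂ = 0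
      · refine ⟨H₁ + H₂, Ideal.add_mem _ hH₁ hH₂, ?_, ?_⟩
        · rwa [map_add, h₄, add_zero]
        · rwa [map_add, h₃, zero_add]
      · exact ⟨H₂, hH₂, h₄, h₂⟩
    · exact ⟨H₁, hH₁, h₁, h₃⟩
  obtain ⟨a, b, hab⟩ := exists_coverEquation_dvd_sub C H
  rw [mem_coneIdeal, coneMap_eq_of_dvd hC hg hab] at hH
  have hN : q ∣ a ^ 2 - b ^ 2 * C := by
    rw [← aeval_cone_eq_zero_iff hq hx, map_sub, map_mul, map_pow, map_pow, ← coneMap_rename x g C,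
      coneMap_rename_conic hC hg]
    linear_combination hH * (aeval (fun j => Polynomial.C (x j) * Polynomial.X) a -
      aeval (fun j => Polynomial.C (x j) * Polynomial.X) b * (Polynomial.C g * Polynomial.X))
  have key : ∀ v : ℂ, v ^ 2 = eval p C →
      eval (Fin.snoc p v : Fin 4 → ℂ) H = eval p a + eval p b * v := by
    intro v hv
    obtain ⟨e, he⟩ := hab
    have h1 := congrArg (eval (Fin.snoc p v : Fin 4 → ℂ)) he
    rw [map_mul, coverEquation, map_sub, map_sub, map_pow, map_add, map_mul, eval_snoc_rename,
      eval_snoc_rename, eval_snoc_rename, eval_X, Fin.snoc_last, hv, sub_self, zero_mul,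
      sub_eq_zero] at h1
    exact h1
  rw [key w hw] at h
  rw [key (-w) (by rw [neg_sq, hw])] at h'
  obtain ⟨e, he⟩ := hN
  have h1 := congrArg (eval p) he
  rw [map_mul, hp, zero_mul, map_sub, map_mul, map_pow, map_pow, ← hw] at h1
  exact mul_ne_zero h h' (by linear_combination h1)

variable {g : E} (hg : g ^ 2 = aeval x C) (hg0 : g ≠ 0)

include hg0 in
theorem not_coneIdeal_neg_le_coneIdeal (hs : ∃ (n : ℕ) (A B : PlanePoly),
      A.IsHomogeneous (n + 1) ∧ B.IsHomogeneous n ∧ aeval x B ≠ 0 ∧ aeval x A = aeval x B * g) :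
    ¬ coneIdeal x (-g) ≤ coneIdeal x g := by
  obtain ⟨n, A, B, hA, hB, hB0, hAB⟩ := hs
  have key : ∀ g', coneMap x g' (rename Fin.castSucc B * X (Fin.last 3) + rename Fin.castSucc A) =
      Polynomial.C (aeval x B * (g' + g)) * Polynomial.X ^ (n + 1) := by
    intro g'
    rw [map_add, map_mul, coneMap_rename, coneMap_rename, coneMap_last, aeval_C_mul_X hA,
      aeval_C_mul_X hB, hAB, mul_add, Polynomial.C_add, Polynomial.C_mul, Polynomial.C_mul]
    ring
  intro h
  have h1 := h ((mem_coneIdeal x (-g)).2 (by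
    rw [key, neg_add_cancel, mul_zero, Polynomial.C_0, zero_mul]))
  have : CharZero E := charZero_of_injective_algebraMap (algebraMap ℂ E).injective
  rw [mem_coneIdeal, key, mul_eq_zero, Polynomial.C_eq_zero, ← two_mul] at h1
  exact h1.elim (mul_ne_zero hB0 (mul_ne_zero two_ne_zero hg0))
    (pow_ne_zero _ Polynomial.X_ne_zero)

include hq hx hC hg hg0 in
theorem height_coneIdeal (hq0 : q ≠ 0) (h : ¬ coneIdeal x (-g) ≤ coneIdeal x g) :
    (coneIdeal x g).height = 2 := by
  refine le_antisymm ?_ (two_le_height_coneIdeal hq hx hC hg hq0)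
  have hmin : coneIdeal x g ∈ (pullbackIdeal q C).minimalPrimes := by
    refine ⟨⟨inferInstance, pullbackIdeal_le_coneIdeal hq hx hC hg⟩, ?_⟩
    rintro P ⟨hP, hle⟩ hP'
    rw [← coneIdeal_inf_coneIdeal_neg hq hx hC hg hg0] at hle
    exact (hP.inf_le.1 hle).resolve_right fun h' => h (h'.trans hP')
  refine (Ideal.height_le_card_of_mem_minimalPrimes_span (Set.toFinite _) hmin).trans ?_
  exact_mod_cast Set.ncard_insert_le _ _ |>.trans (by rw [Set.ncard_singleton])

/-- The curve on the double cover with generic point `(x : g)`. -/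
def conePrimeDivisor (hC : C.IsHomogeneous 2) (hg : g ^ 2 = aeval x C)
    (h : (coneIdeal x g).height = 2) : PrimeDivisor C where
  ideal := coneIdeal x g
  isPrime := inferInstance
  homogeneous _ hH n := homogeneousComponent_mem_coneIdeal x g hH n
  height_eq := h
  mem := coverEquation_mem_coneIdeal hC hg

include hq hx in
theorem imageIs_conePrimeDivisor (h : (coneIdeal x g).height = 2) :
    ImageIs (conePrimeDivisor hC hg h) q := by
  refine fun p _ => ⟨?_, exists_eval_eq_zero_of_mem_coneIdeal hC hq hx hg⟩
  rintro ⟨w, hw⟩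
  rw [← eval_snoc_rename p w]
  exact hw _ ((rename_mem_coneIdeal_iff g hq hx q).2 dvd_rfl)

theorem PrimeDivisor.ideal_eq_of_le {D : PrimeDivisor C} {P : Ideal SpacePoly} [P.IsPrime]
    (h : P ≤ D.ideal) (hP : 2 ≤ P.height) : P = D.ideal := by
  have := D.isPrime
  have hfin : P.FiniteHeight := by
    rw [Ideal.finiteHeight_iff]
    right
    exact ((Ideal.height_mono h).trans_lt (by rw [D.height_eq]; exact ENat.natCast_lt_top 2)).ne
  exact Ideal.eq_of_le_of_height_le P h (by rwa [D.height_eq])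

include hq hx hg0 hC hg in
/-- If the equation of the conic is a square in the function field of the curve `q = 0`, then the
conic is a quadratic residue. -/
theorem isQuadraticResidue_of_sq_eq (hq0 : q ≠ 0) (hs : ∃ (n : ℕ) (A B : PlanePoly),
      A.IsHomogeneous (n + 1) ∧ B.IsHomogeneous n ∧ aeval x B ≠ 0 ∧ aeval x A = aeval x B * g) :
    IsQuadraticResidue C q := by
  classical
  have hg' : (-g) ^ 2 = aeval x C := by rw [neg_sq, hg]
  have hn : ¬ coneIdeal x (-g) ≤ coneIdeal x g := not_coneIdeal_neg_le_coneIdeal hg0 hs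
  have hn' : ¬ coneIdeal x g ≤ coneIdeal x (-g) := by
    obtain ⟨n, A, B, hA, hB, hB0, hAB⟩ := hs
    have := not_coneIdeal_neg_le_coneIdeal (neg_ne_zero.2 hg0)
      ⟨n, -A, B, hA.neg, hB, hB0, by rw [map_neg, hAB, mul_neg]⟩
    rwa [neg_neg] at this
  have hh := height_coneIdeal hq hx hC hg hg0 hq0 hn
  have hh' := height_coneIdeal hq hx hC hg' (neg_ne_zero.2 hg0) hq0 (by rwa [neg_neg])
  have hI := coneIdeal_inf_coneIdeal_neg hq hx hC hg hg0
  have hne : conePrimeDivisor hC hg hh ≠ conePrimeDivisor hC hg' hh' := fun h =>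
    hn (congrArg PrimeDivisor.ideal h).ge
  refine ⟨conePrimeDivisor hC hg hh, conePrimeDivisor hC hg' hh', ?_, hne,
    (comap_coverInvolution_coneIdeal x g).symm, imageIs_conePrimeDivisor hq hx hC hg hh,
    imageIs_conePrimeDivisor hq hx hC hg' hh'⟩
  funext D
  have := D.isPrime
  have hD : pullbackDivisor C q D = lengthAt D.ideal (pullbackIdeal q C) := rfl
  rw [hD, ← hI, Pi.add_apply]
  by_cases h1 : D = conePrimeDivisor hC hg hh
  · subst h1
    rw [Pi.single_eq_same, Pi.single_eq_of_ne hne, add_zero]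
    exact lengthAt_inf_eq_one (coneIdeal x g) (coneIdeal x (-g)) hn
  by_cases h2 : D = conePrimeDivisor hC hg' hh'
  · subst h2
    rw [Pi.single_eq_same, Pi.single_eq_of_ne hne.symm, zero_add, inf_comm]
    exact lengthAt_inf_eq_one (coneIdeal x (-g)) (coneIdeal x g) hn'
  rw [Pi.single_eq_of_ne h1, Pi.single_eq_of_ne h2, add_zero]
  refine lengthAt_eq_zero _ fun hle => ?_
  rcases D.isPrime.inf_le.1 hle with h | h
  · exact h1 (PrimeDivisor.ext (PrimeDivisor.ideal_eq_of_le h hh.ge).symm)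
  · exact h2 (PrimeDivisor.ext (PrimeDivisor.ideal_eq_of_le h hh'.ge).symm)

end Split

/-! ### A quadratic residue is a square in the function field -/

/-- If `√C` were of degree two over the function field of `q = 0`, the inverse image of `q = 0` in
the double cover would be irreducible. -/
theorem IsQuadraticResidue.isSquare {K : Type*} [Field K] [Algebra ℂ K] {x : Fin 3 → K}
    {q : PlanePoly} {d : ℕ} (hq : q.IsHomogeneous d) (hq0 : q ≠ 0)
    (hx : ∀ (n : ℕ) (a : PlanePoly), a.IsHomogeneous n → (aeval x a = 0 ↔ q ∣ a))
    {C : PlanePoly} (hC : C.IsHomogeneous 2) (h : IsQuadraticResidue C q) :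
    IsSquare (aeval x C) := by
  classical
  by_contra hsq
  obtain ⟨Dp, Dm, hdiv, hne, -⟩ := h
  let E := AlgebraicClosure K
  let x' : Fin 3 → E := fun j => algebraMap K E (x j)
  have hmap : ∀ a : PlanePoly, aeval x' a = algebraMap K E (aeval x a) := fun a =>
    aeval_algebraMap_apply E x a
  have hx' : ∀ (n : ℕ) (a : PlanePoly), a.IsHomogeneous n → (aeval x' a = 0 ↔ q ∣ a) := by
    intro n a ha
    rw [hmap, map_eq_zero, hx n a ha]
  obtain ⟨g, hg⟩ := IsAlgClosed.exists_pow_nat_eq (aeval x' C) (n := 2) two_pos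
  have hlin : ∀ (n : ℕ) (a b : PlanePoly), a.IsHomogeneous (n + 1) → b.IsHomogeneous n →
      aeval x' a + aeval x' b * g = 0 → aeval x' b = 0 := by
    intro n a b _ _ hab
    by_contra hb
    rw [hmap] at hb
    have hb' : aeval x b ≠ 0 := fun h => hb (by rw [h, map_zero])
    refine hsq ⟨aeval x a / aeval x b, (algebraMap K E).injective ?_⟩
    rw [hmap, hmap] at hab
    have hg' : g = algebraMap K E (-(aeval x a / aeval x b)) := by
      rw [map_neg, map_div₀, ← neg_div, eq_div_iff hb]
      linear_combination hab
    rw [← hmap, ← hg, hg', ← map_pow, neg_sq, sq]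
  have hI := coneIdeal_eq_pullbackIdeal hq hx' hC hg hlin
  have key : ∀ D : PrimeDivisor C, pullbackDivisor C q D ≠ 0 → coneIdeal x' g = D.ideal := by
    intro D hD
    have := D.isPrime
    refine PrimeDivisor.ideal_eq_of_le ?_ (two_le_height_coneIdeal hq hx' hC hg hq0)
    rw [hI]
    by_contra hle
    exact hD (lengthAt_eq_zero D.ideal hle)
  refine hne (PrimeDivisor.ext ((key Dp ?_).symm.trans (key Dm ?_)))
  · rw [hdiv, Pi.add_apply, Pi.single_eq_same]
    exact (lt_of_lt_of_le one_pos le_self_add).ne'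
  · rw [hdiv, Pi.add_apply, Pi.single_eq_same]
    exact (lt_of_lt_of_le one_pos le_add_self).ne'

/-! ### Smooth conics in normal form -/

theorem isHomogeneous_zero_iff_eq_C {σ R : Type*} [CommSemiring R] {a : MvPolynomial σ R}
    (ha : a.IsHomogeneous 0) : a = MvPolynomial.C (coeff 0 a) :=
  totalDegree_eq_zero_iff_eq_C.1 ((totalDegree_zero_iff_isHomogeneous σ).2 ha)

theorem eval_eq_sum_of_isHomogeneous_one {a : PlanePoly} (ha : a.IsHomogeneous 1)
    (p : Fin 3 → ℂ) : eval p a = ∑ j, p j * coeff 0 (pderiv j a) := by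
  conv_lhs => rw [← one_nsmul a, ← ha.sum_X_mul_pderiv, map_sum]
  refine Finset.sum_congr rfl fun j _ => ?_
  rw [map_mul, eval_X]
  conv_lhs => rw [isHomogeneous_zero_iff_eq_C (ha.pderiv (i := j)), eval_C]

theorem two_mul_eval_eq_sum {F : PlanePoly} (hF : F.IsHomogeneous 2) (p : Fin 3 → ℂ) :
    2 * eval p F = ∑ i, p i * eval p (pderiv i F) := by
  have h := congrArg (eval p) hF.sum_X_mul_pderiv
  rw [map_sum, map_nsmul, nsmul_eq_mul] at h
  rw [Nat.cast_ofNat] at h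
  rw [← h]
  exact Finset.sum_congr rfl fun i _ => by rw [map_mul, eval_X]

theorem pderiv_comm {σ R : Type*} [CommRing R] (i j : σ) (F : MvPolynomial σ R) :
    pderiv i (pderiv j F) = pderiv j (pderiv i F) := by
  classical
  have h : ⁅pderiv (R := R) i, pderiv j⁆ =
      (0 : Derivation R (MvPolynomial σ R) (MvPolynomial σ R)) := by
    refine derivation_ext fun l => ?_
    rw [Derivation.commutator_apply, pderiv_X, pderiv_X, Derivation.coe_zero, Pi.zero_apply]
    simp only [Pi.single_apply]
    split_ifs <;> simp
  have := congrArg (fun D => D F) h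
  rw [Derivation.commutator_apply] at this
  exact sub_eq_zero.1 this

/-- A smooth conic is the zero set of a nondegenerate quadratic form: the kernel of the polar form
consists of singular points. -/
theorem IsSmoothConic.exists_quadraticForm {F : PlanePoly} (hF : IsSmoothConic F) :
    ∃ f : QuadraticForm ℂ (Fin 3 → ℂ), (∀ p, f p = eval p F) ∧
      (QuadraticMap.associated f).SeparatingLeft := by
  let M : Matrix (Fin 3) (Fin 3) ℂ := fun i j => coeff 0 (pderiv j (pderiv i F)) / 2
  let B : LinearMap.BilinForm ℂ (Fin 3 → ℂ) := Matrix.toLinearMap₂' ℂ M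
  have hB : ∀ p r, B p r = (∑ i, p i * eval r (pderiv i F)) / 2 := by
    intro p r
    rw [Matrix.toLinearMap₂'_apply, Finset.sum_div]
    refine Finset.sum_congr rfl fun i _ => ?_
    rw [eval_eq_sum_of_isHomogeneous_one hF.homogeneous.pderiv, Finset.mul_sum, Finset.sum_div]
    refine Finset.sum_congr rfl fun j _ => ?_
    simp only [M, smul_eq_mul]
    ring
  have hsymm : ∀ p r, B p r = B r p := by
    intro p r
    rw [Matrix.toLinearMap₂'_apply, Matrix.toLinearMap₂'_apply, Finset.sum_comm]
    refine Finset.sum_congr rfl fun i _ => Finset.sum_congr rfl fun j _ => ?_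
    simp only [M, smul_eq_mul]
    rw [pderiv_comm]
    ring
  refine ⟨LinearMap.BilinMap.toQuadraticMap B, fun p => ?_, fun p hp => ?_⟩
  · rw [LinearMap.BilinMap.toQuadraticMap_apply, hB, ← two_mul_eval_eq_sum hF.homogeneous]
    ring
  · by_contra hp0
    have h1 : ∀ r, B r p = 0 := by
      intro r
      have h2 := hp r
      rw [QuadraticMap.associated_toQuadraticMap, hsymm p r] at h2
      simpa using h2
    have h2 : ∀ i, eval p (pderiv i F) = 0 := by
      intro i
      have h3 := h1 (Pi.single i 1)
      rw [hB] at h3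
      simpa [Pi.single_apply] using h3
    refine hF.smooth p hp0 ⟨?_, h2⟩
    have h3 := two_mul_eval_eq_sum hF.homogeneous p
    simpa [h2] using h3

/-- The conic `x₁ ^ 2 = x₀ x₂` is smooth. -/
theorem isSmoothConic_standard : IsSmoothConic (X 1 ^ 2 - X 0 * X 2 : PlanePoly) where
  homogeneous := ((isHomogeneous_X ℂ 1).pow 2).sub ((isHomogeneous_X ℂ 0).mul (isHomogeneous_X ℂ 2))
  smooth p hp h := by
    have h0 := h.2 0
    have h1 := h.2 1
    have h2 := h.2 2
    simp [pderiv_X] at h0 h1 h2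
    exact hp (funext fun i => by fin_cases i <;> assumption)

/-- Over `ℂ` every smooth conic is `b ^ 2 = a c` in suitable coordinates `a`, `b`, `c`. -/
theorem IsSmoothConic.exists_linearEquiv {F : PlanePoly} (hF : IsSmoothConic F) :
    ∃ e : (Fin 3 → ℂ) ≃ₗ[ℂ] (Fin 3 → ℂ), ∀ p, eval p F = e p 1 ^ 2 - e p 0 * e p 2 := by
  obtain ⟨f, hf, hf'⟩ := hF.exists_quadraticForm
  obtain ⟨f₀, hf₀, hf₀'⟩ := isSmoothConic_standard.exists_quadraticForm
  obtain ⟨e⟩ := QuadraticForm.equivalent_of_isAlgClosed f f₀ hf' hf₀'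
  refine ⟨e.toLinearEquiv, fun p => ?_⟩
  rw [← hf, ← e.map_app p, hf₀]
  simp

/-- The linear form with the coefficients `m`. -/
def linearForm (m : Fin 3 → ℂ) : PlanePoly := ∑ j, MvPolynomial.C (m j) * X j

theorem linearForm_isHomogeneous (m : Fin 3 → ℂ) : (linearForm m).IsHomogeneous 1 :=
  IsHomogeneous.sum _ _ _ fun _ _ => isHomogeneous_C_mul_X _ _

theorem eval_linearForm (e : (Fin 3 → ℂ) →ₗ[ℂ] (Fin 3 → ℂ)) (i : Fin 3) (p : Fin 3 → ℂ) :
    eval p (linearForm fun j => e (Pi.single j 1) i) = e p i := by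
  have hp : p = ∑ j, p j • (Pi.single j 1 : Fin 3 → ℂ) := by
    funext l
    simp [Finset.sum_apply, Pi.single_apply]
  conv_rhs => rw [hp, map_sum, Finset.sum_apply]
  rw [linearForm, map_sum]
  refine Finset.sum_congr rfl fun j _ => ?_
  rw [map_mul, eval_C, eval_X, map_smul, Pi.smul_apply, smul_eq_mul, mul_comm]

theorem IrreduciblePlaneCurve.not_dvd_of_isHomogeneous_one {d : ℕ} (Q : IrreduciblePlaneCurve d)
    (hd : 2 ≤ d) {a : PlanePoly} (ha : a.IsHomogeneous 1) (ha0 : a ≠ 0) : ¬ Q.form ∣ a := by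
  intro h
  have h1 := totalDegree_le_of_dvd_of_isDomain h ha0
  rw [ha.totalDegree ha0, Q.homogeneous.totalDegree Q.irreducible.ne_zero] at h1
  omega

/-! ### Curves of degree four on which a smooth conic is a square -/

section Quartic

open IntermediateField

/-- Let `A` and `B` be the affine coordinates `e₀ / e₂` and `e₁ / e₂` on a quartic `q = 0`, in which
the conic is `B ^ 2 = A`, and suppose that `B ^ 2 - A` is a square `w ^ 2`. Then `u = B - w` and
`v = B + w` are the two rulings of the double cover of the plane. A tangent line of the conic pulls
back to one line of each ruling: `(u - t) (v - t) = A - 2 t B + t ^ 2`. As a line meets the quartic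
in four points, this gives `[K : ℂ(u)] + [K : ℂ(v)] ≤ 4`, and the genus is at most one. -/
theorem genus_le_one_of_sq_sub_eq_mul_self {K : Type*} [Field K] [Algebra ℂ K] [IsCurveField ℂ K]
    {x : Fin 3 → K} {q c : PlanePoly} (hq : q.IsHomogeneous 4) (hq0 : q ≠ 0)
    (hqx : aeval x q = 0) (e : (Fin 3 → ℂ) ≃ₗ[ℂ] (Fin 3 → ℂ)) {m : Fin 3 → Fin 3 → ℂ}
    (hm : ∀ p j, p j = ∑ i, e p i * m i j) (hc0 : c ≠ 0) (hc : ∀ p, eval p c = e p 2) {A B w : K}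
    (hw : B ^ 2 - A = w * w) (hxj : ∀ j, x j = A * algebraMap ℂ K (m 0 j) +
      B * algebraMap ℂ K (m 1 j) + algebraMap ℂ K (m 2 j))
    (hArange : A ∉ Set.range (algebraMap ℂ K))
    (htop : ∀ F : IntermediateField ℂ K, A ∈ F → B ∈ F → F = ⊤) :
    genus ℂ K ≤ 1 := by
  let u := B - w
  let v := B + w
  have huv : u * v = A := by linear_combination hw
  have hadd : u + v = algebraMap ℂ K 2 * B := by
    rw [map_ofNat]
    ring
  have hB' : B = (u + v) * algebraMap ℂ K (1 / 2) := by
    rw [hadd, mul_right_comm, ← map_mul]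
    norm_num
  have huvtop : ∀ F : IntermediateField ℂ K, u ∈ F → v ∈ F → F = ⊤ := by
    intro F hu hv
    refine htop F (huv ▸ mul_mem hu hv) ?_
    rw [hB']
    exact mul_mem (add_mem hu hv) (_root_.algebraMap_mem _ _)
  have hconst : ∀ {f : K} (F : IntermediateField ℂ K),
      f ∈ Set.range (algebraMap ℂ K) → f ∈ F := by
    rintro _ F ⟨r, rfl⟩
    exact _root_.algebraMap_mem _ _
  by_cases hu : u ∈ Set.range (algebraMap ℂ K)
  · by_cases hv : v ∈ Set.range (algebraMap ℂ K)
    · refine absurd ?_ hArange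
      rw [← huv]
      exact (algebraMap ℂ K).range.mul_mem hu hv
    · exact genus_le_one_of_adjoin_eq_top hv
        (huvtop _ (hconst _ hu) (mem_adjoin_simple_self ℂ v))
  by_cases hv : v ∈ Set.range (algebraMap ℂ K)
  · exact genus_le_one_of_adjoin_eq_top hu
      (huvtop _ (mem_adjoin_simple_self ℂ u) (hconst _ hv))
  refine genus_le_one_of_finrank_add_le
    (huvtop _ (subset_adjoin _ _ (by simp)) (subset_adjoin _ _ (by simp))) hu hv ?_
  obtain ⟨t, hN, hfin⟩ := exists_finrank_mul_eq_add hu hv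
  rw [← hfin]
  set N := (u - algebraMap ℂ K t) * (v - algebraMap ℂ K t) with hNdef
  have hNA : N = A - algebraMap ℂ K (2 * t) * B + algebraMap ℂ K (t ^ 2) := by
    rw [hNdef, ← huv, map_mul, map_pow]
    linear_combination (-algebraMap ℂ K t) * hadd
  -- The level curves of `N` are lines, so `N` has degree at most four on the quartic.
  have hAN : A = N + algebraMap ℂ K (2 * t) * B - algebraMap ℂ K (t ^ 2) := by
    rw [hNA]
    ring
  have hNB : adjoin ℂ {N, B} = ⊤ := by
    have hN' : N ∈ adjoin ℂ {N, B} := subset_adjoin _ _ (by simp)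
    have hB'' : B ∈ adjoin ℂ {N, B} := subset_adjoin _ _ (by simp)
    refine htop _ ?_ hB''
    rw [hAN]
    exact sub_mem (add_mem hN' (mul_mem (_root_.algebraMap_mem _ _) hB''))
      (_root_.algebraMap_mem _ _)
  have htr : Transcendental ℂ (AdjoinSimple.gen ℂ N) := by
    intro h
    refine transcendental_of_notMem_range hN ?_
    rw [← AdjoinSimple.algebraMap_gen ℂ N]
    exact h.algebraMap
  have hroot : aeval (fun j => algebraMap ℂ K (m 2 j - m 0 j * t ^ 2) +
      algebraMap ℂ K (m 0 j) *
        algebraMap ℂ⟮N⟯ K (AdjoinSimple.gen ℂ N) +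
      algebraMap ℂ K (m 1 j + 2 * t * m 0 j) * B) q = 0 := by
    rw [← hqx]
    congr 2
    funext j
    rw [hxj, AdjoinSimple.algebraMap_gen, hAN]
    simp only [map_sub, map_add, map_mul, map_pow]
    ring
  obtain ⟨p, hp0, hpd, hpB⟩ := exists_root_of_isHomogeneous hq hq0
    hc0 htr hroot fun p hp => by
      rw [hc] at hp ⊢
      refine ⟨e p 0 / e p 2 - 2 * t * (e p 1 / e p 2) + t ^ 2, e p 1 / e p 2, ?_⟩
      funext j
      rw [hm p j, Fin.sum_univ_three]
      field_simp
      ring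
  exact (finrank_le_of_root hNB hp0 hpd hpB).2

namespace IrreduciblePlaneCurve

/-- A quartic on which the equation `e₁ ^ 2 - e₀ e₂` of a smooth conic is a square has genus at most
one. -/
theorem genus_le_one_of_isSquare (Q : IrreduciblePlaneCurve 4) {C : PlanePoly}
    (e : (Fin 3 → ℂ) ≃ₗ[ℂ] (Fin 3 → ℂ)) (he : ∀ p, eval p C = e p 1 ^ 2 - e p 0 * e p 2)
    (hsq : ∀ {c : PlanePoly} (hc : c.IsHomogeneous 1), Q.toFrac c ≠ 0 →
      IsSquare (aeval (Q.coord hc) C)) :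
    genus ℂ Q.functionField ≤ 1 := by
  let m : Fin 3 → Fin 3 → ℂ := fun i j => e.symm (Pi.single i 1) j
  let ℓ : Fin 3 → PlanePoly := fun i => linearForm fun j => e (Pi.single j 1) i
  have hℓ : ∀ i p, eval p (ℓ i) = e p i := fun i p => eval_linearForm e.toLinearMap i p
  have hℓh : ∀ i, (ℓ i).IsHomogeneous 1 := fun i => linearForm_isHomogeneous _
  have hm : ∀ p j, p j = ∑ i, e p i * m i j := by
    intro p j
    have h := eval_linearForm e.symm.toLinearMap j (e p)
    rw [LinearEquiv.coe_coe, e.symm_apply_apply] at h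
    rw [← h, linearForm, map_sum]
    exact Finset.sum_congr rfl fun i _ => by rw [map_mul, eval_C, eval_X, mul_comm]
  have hC : C = ℓ 1 ^ 2 - ℓ 0 * ℓ 2 := by
    refine MvPolynomial.funext fun p => ?_
    rw [he, map_sub, map_mul, map_pow, hℓ, hℓ, hℓ]
  have hX : ∀ j, (X j : PlanePoly) = ∑ i, ℓ i * MvPolynomial.C (m i j) := by
    intro j
    refine MvPolynomial.funext fun p => ?_
    rw [eval_X, hm p j, map_sum]
    exact Finset.sum_congr rfl fun i _ => by rw [map_mul, eval_C, hℓ]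
  have hne : ∀ {a : PlanePoly} (i : Fin 3), eval (e.symm (Pi.single i 1)) a ≠ 0 → a ≠ 0 := by
    rintro a i h rfl
    exact h (map_zero _)
  have hℓ2 : ℓ 2 ≠ 0 := hne 2 (by rw [hℓ]; simp)
  have hc := hℓh 2
  have hc0 : Q.toFrac (ℓ 2) ≠ 0 := by
    rw [Ne, toFrac_eq_zero_iff]
    exact Q.not_dvd_of_isHomogeneous_one (by norm_num) hc hℓ2
  obtain ⟨w, hw⟩ := hsq hc hc0
  set x := Q.coord hc with hx
  set A := aeval x (ℓ 0) with hA
  set B := aeval x (ℓ 1) with hB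
  have h1 : aeval x (ℓ 2) = 1 := Q.aeval_coord_self hc hc0
  rw [hC, map_sub, map_mul, map_pow, h1, mul_one, ← hA, ← hB] at hw
  have hxj : ∀ j, x j = A * algebraMap ℂ _ (m 0 j) + B * algebraMap ℂ _ (m 1 j) +
      algebraMap ℂ _ (m 2 j) := by
    intro j
    have h := congrArg (aeval x) (hX j)
    rw [aeval_X, map_sum, Fin.sum_univ_three, map_mul, map_mul, map_mul, aeval_C, aeval_C,
      aeval_C, h1, one_mul] at h
    exact h
  have hArange : A ∉ Set.range (algebraMap ℂ Q.functionField) := by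
    rintro ⟨r, hr⟩
    have h0 : aeval x (ℓ 0 - MvPolynomial.C r * ℓ 2) = 0 := by
      rw [map_sub, map_mul, h1, aeval_C, mul_one, hr, ← hA, sub_self]
    have hh : (ℓ 0 - MvPolynomial.C r * ℓ 2).IsHomogeneous 1 :=
      (hℓh 0).sub ((hℓh 2).C_mul r)
    refine Q.not_dvd_of_isHomogeneous_one (by norm_num) hh (hne 0 ?_)
      ((Q.aeval_coord_eq_zero_iff hc hc0 hh).1 h0)
    rw [map_sub, map_mul, hℓ, hℓ, e.apply_symm_apply]
    simp
  refine genus_le_one_of_sq_sub_eq_mul_self Q.homogeneous Q.irreducible.ne_zero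
    ((Q.aeval_coord_eq_zero_iff hc hc0 Q.homogeneous).2 dvd_rfl) e hm hℓ2 (hℓ 2) hw hxj hArange ?_
  intro F hAF hBF
  refine Q.eq_top_of_coord_mem hc hc0 fun j => ?_
  rw [← hx, hxj]
  exact add_mem (add_mem (mul_mem hAF (_root_.algebraMap_mem _ _))
    (mul_mem hBF (_root_.algebraMap_mem _ _))) (_root_.algebraMap_mem _ _)

end IrreduciblePlaneCurve

end Quartic

end QuarticConic

end

theorem lemma2p3 (Q : QuarticConic.IrreduciblePlaneCurve 4) :
    (2 ≤ Q.genusOfNormalization →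
      ¬ ∃ C : QuarticConic.PlanePoly, QuarticConic.IsSmoothConic C ∧
        QuarticConic.EvenTangential C Q.form ∧ QuarticConic.IsQuadraticResidue C Q.form) ∧
    (Q.genusOfNormalization = 0 →
      ∀ C : QuarticConic.PlanePoly, QuarticConic.IsSmoothConic C →
        QuarticConic.EvenTangential C Q.form → QuarticConic.IsQuadraticResidue C Q.form) := by
  refine ⟨?_, fun hg C hC hT => ?_⟩
  · rintro hg ⟨C, hC, -, hR⟩
    obtain ⟨e, he⟩ := hC.exists_linearEquiv
    have h1 : Q.genusOfNormalization ≤ 1 := Q.genus_le_one_of_isSquare e he fun hc hc0 =>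
      hR.isSquare Q.homogeneous Q.irreducible.ne_zero
        (fun _ _ ha => Q.aeval_coord_eq_zero_iff hc hc0 ha) hC.homogeneous
    exact absurd (hg.trans h1) (by norm_num)
  · obtain ⟨i, hi⟩ := Q.exists_toFrac_X_ne_zero
    have hc := MvPolynomial.isHomogeneous_X ℂ i
    have hx : ∀ (n : ℕ) (a : QuarticConic.PlanePoly), a.IsHomogeneous n →
        (MvPolynomial.aeval (Q.coord hc) a = 0 ↔ Q.form ∣ a) := fun _ _ ha =>
      Q.aeval_coord_eq_zero_iff hc hi ha
    have hQC : ¬ Q.form ∣ C := fun h =>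
      Q.irreducible.not_isUnit (hT.no_common_component h dvd_rfl)
    have h0 : MvPolynomial.aeval (Q.coord hc) C ≠ 0 := (hx 2 C hC.homogeneous).not.2 hQC
    obtain ⟨g, hsq⟩ := QuarticConic.isSquare_of_even_ord hg h0
      (Q.even_ord_aeval_coord hc hi even_two hC.homogeneous hQC
        (fun p hp hpC hpQ => (hT.smooth p hp hpC hpQ).2) hT.even)
    have hg0 : g ≠ 0 := by
      rintro rfl
      exact h0 (by rw [hsq, mul_zero])
    obtain ⟨n, a, b, ha, hb, hb0, hab⟩ := Q.exists_forms hc hi g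
    refine QuarticConic.isQuadraticResidue_of_sq_eq Q.homogeneous hx hC.homogeneous
      (by rw [sq, hsq]) hg0 Q.irreducible.ne_zero
      ⟨n, a * MvPolynomial.X i, b, ha.mul hc, hb, hb0, ?_⟩
    rw [map_mul, Q.aeval_coord_self hc hi, mul_one, hab, mul_div_cancel₀ _ hb0]
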